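/- All Hilbert spaces are finite-dimensional and nonzero. Fix $n$ untrusted parties, numbers of settings $m_i\ge 1$ and of outcomes $k_i\ge 1$, and spaces $H_C=\mathbb C^{d_C}$, $H_{\tilde C}=\mathbb C^{d_{\tilde C}}$ with $d_C,d_{\tilde C}\ge 1$. Let $\dim H_{X_i}=m_i$, $\dim H_{A_i}=k_i$, and let $H_Y$ be a Hilbert space with a fixed unit vector $|0_Y\rangle$. Write $\mathbf x=(x_1,\dots,x_n)$ and $\mathbf a=(a_1,\dots,a_n)$ with $x_i\in\{0,\dots,m_i-1\}$, $a_i\in\{0,\dots,k_i-1\}$; a channel is a completely positive trace preserving map. Let $\mathcal J^{-1}(Z)(X)=d_C\,\mathrm{Tr}_C[(\mathbb 1_{\tilde C}\otimes X^T)Z]$ be the inverse Choi–Jamiołkowski isomorphism. A family $\mathcal L=\{\Lambda_{\mathbf a|\mathbf x}\}$ of completely positive maps $B(H_C)\to B(H_{\tilde C})$ is - a no-signaling channel assemblage if $\sum_{\mathbf a}\Lambda_{\mathbf a|\mathbf x}$ is a channel that does not depend on $\mathbf x$ and, for every nonempty proper $I\subset\{1,\dots,n\}$, the sum $\sum_{a_j,\,j\notin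 I}\Lambda_{\mathbf a|\mathbf x}$ depends only on $(a_i)_{i\in I}$ and $(x_i)_{i\in I}$; - a quantum channel assemblage if there are Hilbert spaces $H_1,\dots,H_n$, a state $\rho$ on $\bigotimes_i H_i$, POVMs $\{M^{(i)}_{a|x}\}_a$ on $H_i$ and a channel $\mathcal E:\bigotimes_i B(H_i)\otimes B(H_C)\to\bigotimes_i B(H_i)\otimes B(H_{\tilde C})$ with $\Lambda_{\mathbf a|\mathbf x}(\rho_C)=\mathrm{Tr}_{1\ldots n}[(\bigotimes_i M^{(i)}_{a_i|x_i}\otimes\mathbb 1)\,\mathcal E(\rho\otimes\rho_C)]$ for every state $\rho_C$; - a local channel assemblage if $\Lambda_{\mathbf a|\mathbf x}=\sum_j\prod_i p^{(i)}_j(a_i|x_i)\Lambda_j$ (a finite sum) for conditional probability distributions $p^{(i)}_j$ and completely positive maps $\Lambda_j$ such that $\sum_j\Lambda_j$ is a channel. Let $\Phi:\bigotimes_{i=1}^n B(H_{X_i})\otimes B(H_Y)\to\bigotimes_{i=1}^n B(H_{A_i})\otimes B(H_{\tilde C})\otimes B(H_C)$ be a channel, regarded as a channel of $n+1$ parties,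 where party $i\le n$ has input $X_i$ and output $A_i$ and the last party has input $Y$ and output $\tilde C C$. It is causal if for every set $S$ of parties there is a channel $\Phi_S$ such that the output of $\Phi$ reduced to $S$ is $\Phi_S$ of the input reduced to $S$. It is localizable if it is implemented by a product of local channels, each acting on the input of one party and on that party's share of a common (possibly entangled) state. It is local if it is a finite convex combination of products of local channels. **Theorem.** A family $\mathcal L=\{\Lambda_{\mathbf a|\mathbf x}\}$ of completely positive maps $B(H_C)\to B(H_{\tilde C})$ is a no-signaling (respectively quantum, local) channel assemblage if and only if there exist a causal (respectively localizable, local) channel $\Phi$ as above and orthonormal bases $\{|a_i\rangle\}$ of $H_{A_i}$ and $\{|x_i\rangle\}$ of $H_{X_i}$ such that, for all $\mathbf a,\mathbf x$, $$\Lambda_{\mathbf a|\mathbf x}=\mathcal J^{-1}\Big[\mathrm{Tr}_{A_1\ldots A_n}\Big(\big(\textstyle\bigotimes_i|a_i\rangle\langle a_i|\otimes\mathbb 1_{\tilde C C}\big)\,\Phi\big(\bigotimes_i|x_i\rangle\langle x_i|\otimes|0_Y\rangle\langle 0_Y|\big)\Big)\Big]$$ and $$\mathrm{Tr}_{A_1\ldots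 A_n\tilde C}\Big[\Phi\big(\textstyle\bigotimes_i|x_i\rangle\langle x_i|\otimes|0_Y\rangle\langle 0_Y|\big)\Big]=\frac{\mathbb 1}{d_C}.$$ -/

import Mathlib

open scoped ComplexOrder Kronecker

noncomputable section

namespace ChannelAssemblage

/-- Linear maps `B(ℂ^α) → B(ℂ^β)`, operators being matrices in the standard bases. -/
abbrev SuperOp (α β : Type) : Type := Matrix α α ℂ →ₗ[ℂ] Matrix β β ℂ

/-! ### States, measurements and channels in finite dimension -/

/-- The map `Φ ⊗ id_k`, applied to an operator on `ℂ^α ⊗ ℂ^k`. -/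
def ampliation {α β : Type} (Φ : SuperOp α β) (k : ℕ)
    (M : Matrix (α × Fin k) (α × Fin k) ℂ) : Matrix (β × Fin k) (β × Fin k) ℂ :=
  Matrix.of fun u v => Φ (Matrix.of fun p q => M (p, u.2) (q, v.2)) u.1 v.1

/-- Complete positivity: every `Φ ⊗ id_k` preserves positivity. -/
def IsCP {α β : Type} (Φ : SuperOp α β) : Prop :=
  ∀ (k : ℕ) (M : Matrix (α × Fin k) (α × Fin k) ℂ),
    M.PosSemidef → (ampliation Φ k M).PosSemidef

/-- A quantum channel: a completely positive and trace preserving map. -/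
def IsChannel {α β : Type} [Fintype α] [Fintype β] (Φ : SuperOp α β) : Prop :=
  IsCP Φ ∧ ∀ M, (Φ M).trace = M.trace

/-- A density operator. -/
def IsState {α : Type} [Fintype α] (ρ : Matrix α α ℂ) : Prop :=
  ρ.PosSemidef ∧ ρ.trace = 1

/-- A POVM with outcomes in `ω`. -/
def IsPOVM {α ω : Type} [Fintype ω] [DecidableEq α] (M : ω → Matrix α α ℂ) : Prop :=
  (∀ a, (M a).PosSemidef) ∧ ∑ a, M a = 1

/-- The operator `|v⟩⟨v|`. -/
def ketbra {α : Type} (v : EuclideanSpace ℂ α) : Matrix α α ℂ :=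
  Matrix.of fun p q => v p * star (v q)

/-! ### Operators on a tensor product of a finite family of systems

The space `⨂ᵢ ℂ^(X i)` has its product basis indexed by `∀ i, X i`. -/

/-- The operator `⨂ᵢ Mᵢ`. -/
def piTensor {ι : Type} [Fintype ι] {X : ι → Type} (M : ∀ i, Matrix (X i) (X i) ℂ) :
    Matrix (∀ i, X i) (∀ i, X i) ℂ :=
  Matrix.of fun u v => ∏ i, M i (u i) (v i)

/-- The map `⨂ᵢ Tᵢ`: the linear map that sends a tensor product of matrix units to the tensor
product of their images. -/
def tensorMap {ι : Type} [Fintype ι] [DecidableEq ι] {X A : ι → Type}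
    [∀ i, Fintype (X i)] [∀ i, DecidableEq (X i)] (T : ∀ i, SuperOp (X i) (A i)) :
    SuperOp (∀ i, X i) (∀ i, A i) where
  toFun M := ∑ u, ∑ v, M u v • piTensor fun i => T i (Matrix.single (u i) (v i) 1)
  map_add' M N := by
    simp only [Matrix.add_apply, add_smul, Finset.sum_add_distrib]
  map_smul' c M := by
    simp only [Matrix.smul_apply, smul_eq_mul, mul_smul, Finset.smul_sum, RingHom.id_apply]

/-- The reduced operator on the systems in `S`: the partial trace over all systems outside `S`. -/
def marginal {ι : Type} [Fintype ι] [DecidableEq ι] {X : ι → Type} [∀ i, Fintype (X i)]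
    (S : Finset ι) (M : Matrix (∀ i, X i) (∀ i, X i) ℂ) :
    Matrix (∀ i : {i // i ∈ S}, X i) (∀ i : {i // i ∈ S}, X i) ℂ :=
  Matrix.of fun u v => ∑ w : ∀ i : {i // i ∉ S}, X i,
    M ((Equiv.piEquivPiSubtypeProd (· ∈ S) X).symm (u, w))
      ((Equiv.piEquivPiSubtypeProd (· ∈ S) X).symm (v, w))

/-- The operator `M ⊗ σ` for `M` on `⨂ᵢ ℂ^(X i)` and `σ` on `⨂ᵢ ℂ^(R i)`, regarded as an
operator on `⨂ᵢ (ℂ^(X i) ⊗ ℂ^(R i))`. -/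
def withAncilla {ι : Type} {X R : ι → Type} (M : Matrix (∀ i, X i) (∀ i, X i) ℂ)
    (σ : Matrix (∀ i, R i) (∀ i, R i) ℂ) :
    Matrix (∀ i, X i × R i) (∀ i, X i × R i) ℂ :=
  Matrix.of fun u v =>
    M (fun i => (u i).1) (fun i => (v i).1) * σ (fun i => (u i).2) (fun i => (v i).2)

/-! ### Causal, localizable and local multipartite channels

Party `i` has input space `ℂ^(X i)` and output space `ℂ^(A i)`. -/

section Multipartite

variable {ι : Type} [Fintype ι] [DecidableEq ι] {X A : ι → Type}
  [∀ i, Fintype (X i)] [∀ i, DecidableEq (X i)] [∀ i, Fintype (A i)]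

/-- A causal (no-signaling) channel: for every group `S` of parties the reduced output of `S`
is obtained through a channel from the reduced input of `S`. -/
def IsCausal (Φ : SuperOp (∀ i, X i) (∀ i, A i)) : Prop :=
  IsChannel Φ ∧ ∀ S : Finset ι,
    ∃ Ψ : SuperOp (∀ i : {i // i ∈ S}, X i) (∀ i : {i // i ∈ S}, A i),
      IsChannel Ψ ∧ ∀ M, marginal S (Φ M) = Ψ (marginal S M)

/-- A localizable channel: it is implemented by local channels, each acting on the input of one
party and on that party's share of a (possibly entangled) state `σ` common to all parties. -/
def IsLocalizable (Φ : SuperOp (∀ i, X i) (∀ i, A i)) : Prop :=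
  ∃ (r : ι → ℕ) (σ : Matrix (∀ i, Fin (r i)) (∀ i, Fin (r i)) ℂ)
    (T : ∀ i, SuperOp (X i × Fin (r i)) (A i)),
    IsState σ ∧ (∀ i, IsChannel (T i)) ∧ ∀ M, Φ M = tensorMap T (withAncilla M σ)

/-- A local channel: a convex combination of product channels (local channels that are
coordinated through shared classical randomness). -/
def IsLocal (Φ : SuperOp (∀ i, X i) (∀ i, A i)) : Prop :=
  ∃ (N : ℕ) (q : Fin N → ℝ) (T : Fin N → ∀ i, SuperOp (X i) (A i)),
    (∀ j, 0 ≤ q j) ∧ ∑ j, q j = 1 ∧ (∀ j i, IsChannel (T j i)) ∧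
      Φ = ∑ j, (q j : ℂ) • tensorMap (T j)

end Multipartite

/-! ### Channel assemblages

There are `n` untrusted parties; party `i` has `m i` settings and `k i` outcomes. -/

/-- A family `Λ_{a|x}` of linear maps `B(ℂ^dC) → B(ℂ^dC')`. -/
abbrev Family {n : ℕ} (m k : Fin n → ℕ) (dC dC' : ℕ) : Type :=
  (∀ i, Fin (k i)) → (∀ i, Fin (m i)) → SuperOp (Fin dC) (Fin dC')

section Assemblages

variable {n : ℕ} {m k : Fin n → ℕ} {dC dC' : ℕ}

/-- No-signaling channel assemblages. -/
def IsNSAssemblage (Λ : Family m k dC dC') : Prop :=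
  (∀ a x, IsCP (Λ a x)) ∧
  (∃ Λ₀ : SuperOp (Fin dC) (Fin dC'), IsChannel Λ₀ ∧ ∀ x, ∑ a, Λ a x = Λ₀) ∧
  ∀ I : Finset (Fin n), I.Nonempty → I ≠ Finset.univ →
    ∃ L : (∀ i : {i // i ∈ I}, Fin (k i)) → (∀ i : {i // i ∈ I}, Fin (m i)) →
        SuperOp (Fin dC) (Fin dC'),
      ∀ (a : ∀ i : {i // i ∈ I}, Fin (k i)) (x : ∀ i, Fin (m i)),
        ∑ b : ∀ i : {i // i ∉ I}, Fin (k i),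
            Λ ((Equiv.piEquivPiSubtypeProd (· ∈ I) fun i => Fin (k i)).symm (a, b)) x
          = L a fun i => x i

/-- The partial trace over the first factor. -/
def traceFst {α β : Type} [Fintype α] (M : Matrix (α × β) (α × β) ℂ) : Matrix β β ℂ :=
  Matrix.of fun p q => ∑ s, M (s, p) (s, q)

/-- The partial trace over the second factor. -/
def traceSnd {α β : Type} [Fintype β] (M : Matrix (α × β) (α × β) ℂ) : Matrix α α ℂ :=
  Matrix.of fun p q => ∑ s, M (p, s) (q, s)

/-- Quantum channel assemblages: `Λ_{a|x}(ρ_C) = Tr_{A₁…Aₙ}[(⨂ᵢ Mᵢ_{aᵢ|xᵢ} ⊗ 1) E(ρ_A ⊗ ρ_C)]`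
for a state `ρ_A`, POVMs `Mᵢ_{·|xᵢ}` and a channel `E`. -/
def IsQuantumAssemblage (Λ : Family m k dC dC') : Prop :=
  (∀ a x, IsCP (Λ a x)) ∧
  ∃ (d : Fin n → ℕ) (ρA : Matrix (∀ i, Fin (d i)) (∀ i, Fin (d i)) ℂ)
    (P : ∀ i, Fin (m i) → Fin (k i) → Matrix (Fin (d i)) (Fin (d i)) ℂ)
    (E : SuperOp ((∀ i, Fin (d i)) × Fin dC) ((∀ i, Fin (d i)) × Fin dC')),
    IsState ρA ∧ (∀ i y, IsPOVM (P i y)) ∧ IsChannel E ∧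
      ∀ a x (ρC : Matrix (Fin dC) (Fin dC) ℂ), IsState ρC →
        Λ a x ρC =
          traceFst ((piTensor (fun i => P i (x i) (a i)) ⊗ₖ
            (1 : Matrix (Fin dC') (Fin dC') ℂ)) * E (ρA ⊗ₖ ρC))

/-- Local channel assemblages: `Λ_{a|x} = ∑ⱼ ∏ᵢ pⱼⁱ(aᵢ|xᵢ) Λⱼ`, with `p j i y b = pⱼⁱ(b|y)`. -/
def IsLocalAssemblage (Λ : Family m k dC dC') : Prop :=
  (∀ a x, IsCP (Λ a x)) ∧
  ∃ (N : ℕ) (p : Fin N → ∀ i, Fin (m i) → Fin (k i) → ℝ)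
    (L : Fin N → SuperOp (Fin dC) (Fin dC')),
    (∀ j i y b, 0 ≤ p j i y b) ∧ (∀ j i y, ∑ b, p j i y b = 1) ∧
      (∀ j, IsCP (L j)) ∧ IsChannel (∑ j, L j) ∧
      ∀ a x, Λ a x = ∑ j, ((∏ i, p j i (x i) (a i) : ℝ) : ℂ) • L j

end Assemblages

/-! ### The channel side -/

/-- The inverse Choi–Jamiołkowski isomorphism
`J⁻¹(Y)(X) = d_A Tr_A[(1 ⊗ Xᵀ) Y]` for `Y` on `ℂ^β ⊗ ℂ^d`. -/
def choiInv {β : Type} [Fintype β] [DecidableEq β] {d : ℕ}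
    (Y : Matrix (β × Fin d) (β × Fin d) ℂ) : SuperOp (Fin d) β where
  toFun Z := (d : ℂ) • traceSnd (((1 : Matrix β β ℂ) ⊗ₖ Z.transpose) * Y)
  map_add' Z W := by
    ext p q
    simp [traceSnd, Matrix.kronecker_add, Matrix.add_mul, Finset.sum_add_distrib, mul_add]
  map_smul' c Z := by
    ext p q
    simp [traceSnd, Matrix.kronecker_smul, Finset.mul_sum, mul_left_comm]

/-- The family of `n + 1` systems whose `i`-th member has dimension `d i` (for `i : Fin n`, as
`some i`) and whose last member (`none`) has its basis indexed by `T`. -/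
def Sys {n : ℕ} (d : Fin n → ℕ) (T : Type) : Option (Fin n) → Type
  | none => T
  | some i => Fin (d i)

instance {n : ℕ} (d : Fin n → ℕ) (T : Type) [Fintype T] : ∀ o, Fintype (Sys d T o)
  | none => inferInstanceAs (Fintype T)
  | some i => inferInstanceAs (Fintype (Fin (d i)))

instance {n : ℕ} (d : Fin n → ℕ) (T : Type) [DecidableEq T] : ∀ o, DecidableEq (Sys d T o)
  | none => inferInstanceAs (DecidableEq T)
  | some i => inferInstanceAs (DecidableEq (Fin (d i)))

/-- The basis index of the `n + 1` systems with entries `a` and `t`. -/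
def joinIdx {n : ℕ} {d : Fin n → ℕ} {T : Type} (a : ∀ i, Fin (d i)) (t : T) :
    ∀ o, Sys d T o
  | none => t
  | some i => a i

/-- The operator `⨂ᵢ Mᵢ ⊗ N` on the `n + 1` systems. -/
def joinOp {n : ℕ} {d : Fin n → ℕ} {T : Type} (M : ∀ i, Matrix (Fin (d i)) (Fin (d i)) ℂ)
    (N : Matrix T T ℂ) : Matrix (∀ o, Sys d T o) (∀ o, Sys d T o) ℂ :=
  piTensor fun o => match o with
    | none => (N : Matrix (Sys d T none) (Sys d T none) ℂ)
    | some i => (M i : Matrix (Sys d T (some i)) (Sys d T (some i)) ℂ)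

/-- The partial trace over the first `n` of the `n + 1` systems. -/
def traceParties {n : ℕ} {d : Fin n → ℕ} {T : Type}
    (M : Matrix (∀ o, Sys d T o) (∀ o, Sys d T o) ℂ) : Matrix T T ℂ :=
  Matrix.of fun s t => ∑ a : ∀ i, Fin (d i), M (joinIdx a s) (joinIdx a t)

/-- The channel `Φ : ⨂ᵢ B(H_{Xᵢ}) ⊗ B(H_Y) → ⨂ᵢ B(H_{Aᵢ}) ⊗ B(H_{C'}) ⊗ B(H_C)`, with the vector
`|0_Y⟩ = y` and the orthonormal bases `eA i` of `H_{Aᵢ}` and `eX i` of `H_{Xᵢ}`, generates the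
family `Λ`. Here `H_Y` belongs to the last party's input, `H_{C'} ⊗ H_C` is its output. -/
def Generates {n : ℕ} {m k : Fin n → ℕ} {dC dC' dY : ℕ}
    (Φ : SuperOp (∀ o, Sys m (Fin dY) o) (∀ o, Sys k (Fin dC' × Fin dC) o))
    (eA : ∀ i, OrthonormalBasis (Fin (k i)) ℂ (EuclideanSpace ℂ (Fin (k i))))
    (eX : ∀ i, OrthonormalBasis (Fin (m i)) ℂ (EuclideanSpace ℂ (Fin (m i))))
    (y : EuclideanSpace ℂ (Fin dY)) (Λ : Family m k dC dC') : Prop :=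
  (∀ a x, Λ a x = choiInv (traceParties
      (joinOp (fun i => ketbra (eA i (a i))) (1 : Matrix (Fin dC' × Fin dC) (Fin dC' × Fin dC) ℂ) *
        Φ (joinOp (fun i => ketbra (eX i (x i))) (ketbra y))))) ∧
  ∀ x : ∀ i, Fin (m i), traceFst (traceParties (Φ (joinOp (fun i => ketbra (eX i (x i))) (ketbra y)))) =
    (1 / (dC : ℂ)) • (1 : Matrix (Fin dC) (Fin dC) ℂ)

end ChannelAssemblage

end

/-!
The Choi–Jamiołkowski isomorphism turns a channel assemblage into an ensemble of positive operators
on `C' ⊗ C` whose reduced operator on `C` is `1 / d_C`, and the channels `Φ` of the theorem are the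
devices that read the classical settings `x`, write the outcomes `a`, and leave the Choi matrix of
`Λ_{a|x}` with the last party. Each of the three equivalences translates one structure across this
dictionary. On the way from `Λ` to `Φ` the standard bases are used, and it suffices to match Choi
matrices (`generates_of_choi`).

No-signaling and causal: `Φ` measures its input in the product basis and prepares the state
`∑ₐ |a⟩⟨a| ⊗ J(Λ_{a|x})`. The reduced states of this ensemble depend only on the settings of the
remaining parties (`marginal_outputState`), which makes `Φ` causal (`isCausal_measurePrepare`).
Conversely, summing over the outcomes outside `I` replaces the projectors there by the identity, so
that only the reduced output of `I` and the last party enters, and causality removes the dependence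
on the other settings (`IsCausal.traceParties_eq`).

Quantum and localizable: given `ρ`, the POVMs and `E`, the parties share the state
`(E ⊗ id)(ρ ⊗ |Ω⟩⟨Ω|)` with `|Ω⟩` maximally entangled between `C` and a copy of it; the untrusted
parties measure, and the last one outputs its share. Measuring produces precisely the Choi matrices
(`traceFst_mul_steeredState`). Conversely, in the Heisenberg picture the local channels and the
projectors on `|aᵢ⟩` combine into POVMs on the shares (`isPOVM_dualOp`), the last local channel
turns the shared state into an operator `τ` (`applyLast`), and `E` is the channel that discards its
first input and applies the map with Choi matrix `τ` to the second (`discardChoi`).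

Local: a hidden variable `j` is drawn with probability `Tr J(Λⱼ)`, and the parties then act
independently; conversely the product channels yield the response functions and the maps `Λⱼ`
directly.

The computations rest on two facts: the entries of a conditional output of `Φ` are expectation
values of product operators (`traceParties_joinOp_mul_apply`), and such expectation values factor
on tensor products (`trace_joinOp`, `traceParties_joinOp_mul_tensorMap`).
-/

open scoped ComplexOrder Kronecker

noncomputable section

namespace ChannelAssemblage

/-! ### Tensor products of operators -/

section TensorProducts

variable {ι : Type} [Fintype ι] {X A R : ι → Type}

lemma piTensor_mul [DecidableEq ι] [∀ i, Fintype (X i)] (M N : ∀ i, Matrix (X i) (X i) ℂ) :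
    piTensor M * piTensor N = piTensor fun i => M i * N i := by
  ext u v
  simp only [Matrix.mul_apply, piTensor, Matrix.of_apply, ← Finset.prod_mul_distrib]
  rw [Finset.prod_univ_sum, Fintype.piFinset_univ]

lemma trace_piTensor [DecidableEq ι] [∀ i, Fintype (X i)] (M : ∀ i, Matrix (X i) (X i) ℂ) :
    (piTensor M).trace = ∏ i, (M i).trace := by
  simp only [Matrix.trace, Matrix.diag_apply, piTensor, Matrix.of_apply]
  rw [Finset.prod_univ_sum, Fintype.piFinset_univ]

lemma piTensor_one [∀ i, DecidableEq (X i)] [DecidableEq (∀ i, X i)] :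
    piTensor (fun i => (1 : Matrix (X i) (X i) ℂ)) = 1 := by
  ext u v
  simp only [piTensor, Matrix.of_apply, Matrix.one_apply, Finset.prod_ite_zero,
    Finset.prod_const_one, Finset.mem_univ, true_imp_iff, funext_iff]

lemma piTensor_single [∀ i, DecidableEq (X i)] [DecidableEq (∀ i, X i)] (u v : ∀ i, X i) :
    piTensor (fun i => Matrix.single (u i) (v i) (1 : ℂ)) = Matrix.single u v 1 := by
  ext p q
  simp only [piTensor, Matrix.of_apply, Matrix.single_apply, Finset.prod_ite_zero,
    Finset.prod_const_one, Finset.mem_univ, true_imp_iff, funext_iff, forall_and]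

lemma posSemidef_piTensor [DecidableEq ι] [∀ i, Fintype (X i)] {M : ∀ i, Matrix (X i) (X i) ℂ}
    (hM : ∀ i, (M i).PosSemidef) : (piTensor M).PosSemidef := by
  classical
  -- Factor each `M i` as `Bᴴ B`; the tensor product then factors in the same way.
  have h : ∀ i, ∃ B : Matrix (X i) (X i) ℂ, M i = B.conjTranspose * B := fun i => by
    open scoped MatrixOrder in
    exact CStarAlgebra.nonneg_iff_eq_star_mul_self.mp (Matrix.nonneg_iff_posSemidef.mpr (hM i))
  choose B hB using h
  have : piTensor M = (piTensor B).conjTranspose * piTensor B := by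
    have : (piTensor B).conjTranspose = piTensor fun i => (B i).conjTranspose := by
      ext u v
      simp [piTensor, Matrix.conjTranspose_apply, star_prod]
    rw [this, piTensor_mul]
    exact congrArg _ (funext hB)
  rw [this]
  exact Matrix.posSemidef_conjTranspose_mul_self _

lemma prod_sum_sum [DecidableEq ι] [∀ i, Fintype (X i)] (f : ∀ i, X i → X i → ℂ) :
    ∏ i, ∑ p, ∑ q, f i p q = ∑ u : ∀ i, X i, ∑ v : ∀ i, X i, ∏ i, f i (u i) (v i) := by
  rw [Finset.prod_univ_sum, Fintype.piFinset_univ]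
  refine Finset.sum_congr rfl fun u _ => ?_
  rw [Finset.prod_univ_sum, Fintype.piFinset_univ]

variable [DecidableEq ι] [∀ i, Fintype (X i)] [∀ i, DecidableEq (X i)]

lemma superOp_eq_sum {α β : Type} [Fintype α] [DecidableEq α] (T : SuperOp α β)
    (M : Matrix α α ℂ) : T M = ∑ p, ∑ q, M p q • T (Matrix.single p q 1) := by
  conv_lhs => rw [Matrix.matrix_eq_sum_single M]
  simp only [map_sum, ← map_smul, Matrix.smul_single, smul_eq_mul, mul_one]

lemma tensorMap_apply (T : ∀ i, SuperOp (X i) (A i)) (M : Matrix (∀ i, X i) (∀ i, X i) ℂ) :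
    tensorMap T M =
      ∑ u, ∑ v, M u v • piTensor fun i => T i (Matrix.single (u i) (v i) 1) := rfl

lemma tensorMap_piTensor (T : ∀ i, SuperOp (X i) (A i)) (M : ∀ i, Matrix (X i) (X i) ℂ) :
    tensorMap T (piTensor M) = piTensor fun i => T i (M i) := by
  ext s t
  simp only [tensorMap_apply, piTensor, Matrix.sum_apply, Matrix.smul_apply, Matrix.of_apply,
    smul_eq_mul, ← Finset.prod_mul_distrib]
  rw [← prod_sum_sum fun i p q => M i p q * T i (Matrix.single p q 1) (s i) (t i)]
  refine Finset.prod_congr rfl fun i _ => ?_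
  conv_rhs => rw [superOp_eq_sum]
  simp [Matrix.sum_apply]

/-- The map `N ↦ T (M ⊗ N)` obtained from `T` by fixing the first input. -/
def fixFst {α β ρ : Type} (T : SuperOp (α × ρ) β) (M : Matrix α α ℂ) : SuperOp ρ β where
  toFun N := T (M ⊗ₖ N)
  map_add' := by simp [Matrix.kronecker_add]
  map_smul' := by simp [Matrix.kronecker_smul]

lemma fixFst_apply {α β ρ : Type} (T : SuperOp (α × ρ) β) (M : Matrix α α ℂ) (N : Matrix ρ ρ ℂ) :
    fixFst T M N = T (M ⊗ₖ N) := rfl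

/-- On a product input, local maps that share the state `σ` act on `σ` alone. -/
lemma tensorMap_withAncilla_piTensor [∀ i, Fintype (R i)] [∀ i, DecidableEq (R i)]
    (T : ∀ i, SuperOp (X i × R i) (A i)) (M : ∀ i, Matrix (X i) (X i) ℂ)
    (σ : Matrix (∀ i, R i) (∀ i, R i) ℂ) :
    tensorMap T (withAncilla (piTensor M) σ) = tensorMap (fun i => fixFst (T i) (M i)) σ := by
  -- Both sides are linear in `σ`, so `σ` may be taken to be a product of matrix units.
  have key : ∀ r r' : ∀ i, R i, tensorMap T (withAncilla (piTensor M) (Matrix.single r r' 1)) =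
      tensorMap (fun i => fixFst (T i) (M i)) (Matrix.single r r' 1) := by
    intro r r'
    rw [← piTensor_single, tensorMap_piTensor]
    have : withAncilla (piTensor M) (piTensor fun i => Matrix.single (r i) (r' i) (1 : ℂ)) =
        piTensor fun i => M i ⊗ₖ Matrix.single (r i) (r' i) (1 : ℂ) := by
      ext u v
      simp [withAncilla, piTensor, Finset.prod_mul_distrib]
    rw [this, tensorMap_piTensor]
    rfl
  let W : Matrix (∀ i, R i) (∀ i, R i) ℂ →ₗ[ℂ]
      Matrix (∀ i, X i × R i) (∀ i, X i × R i) ℂ :=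
    { toFun := withAncilla (piTensor M)
      map_add' := fun _ _ => by ext; simp [withAncilla, mul_add]
      map_smul' := fun _ _ => by ext; simp [withAncilla, mul_left_comm] }
  have h1 := superOp_eq_sum (tensorMap T ∘ₗ W) σ
  have h2 := superOp_eq_sum (tensorMap fun i => fixFst (T i) (M i)) σ
  rw [h2]
  refine h1.trans ?_
  exact Finset.sum_congr rfl fun r _ => Finset.sum_congr rfl fun r' _ =>
    congrArg _ (key r r')

end TensorProducts

/-! ### Reduced operators -/

section Marginals

lemma glue_mem {ι : Type} [DecidableEq ι] {X : ι → Type} {S : Finset ι} {i : ι}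
    (hi : i ∈ S) (a : ∀ i : {i // i ∈ S}, X i) (b : ∀ i : {i // i ∉ S}, X i) :
    (Equiv.piEquivPiSubtypeProd (· ∈ S) X).symm (a, b) i = a ⟨i, hi⟩ := by
  simp [Equiv.piEquivPiSubtypeProd, hi]

lemma glue_notMem {ι : Type} [DecidableEq ι] {X : ι → Type} {S : Finset ι} {i : ι}
    (hi : i ∉ S) (a : ∀ i : {i // i ∈ S}, X i) (b : ∀ i : {i // i ∉ S}, X i) :
    (Equiv.piEquivPiSubtypeProd (· ∈ S) X).symm (a, b) i = b ⟨i, hi⟩ := by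
  simp [Equiv.piEquivPiSubtypeProd, hi]

lemma prod_subtype_split {ι : Type} [Fintype ι] [DecidableEq ι] (S : Finset ι) (f : ι → ℂ) :
    ∏ i, f i = (∏ i : {i // i ∈ S}, f i) * ∏ i : {i // i ∉ S}, f i := by
  convert (Fintype.prod_subtype_mul_prod_subtype (· ∈ S) f).symm

lemma prod_glue {ι : Type} [Fintype ι] [DecidableEq ι] {X : ι → Type} (S : Finset ι)
    (f : ∀ i, X i → ℂ) (a : ∀ i : {i // i ∈ S}, X i) (b : ∀ i : {i // i ∉ S}, X i) :
    ∏ i, f i ((Equiv.piEquivPiSubtypeProd (· ∈ S) X).symm (a, b) i) =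
      (∏ i : {i // i ∈ S}, f i (a i)) * ∏ i : {i // i ∉ S}, f i (b i) := by
  rw [prod_subtype_split S]
  congr 1
  · exact Finset.prod_congr rfl fun i _ => by rw [glue_mem i.2]
  · exact Finset.prod_congr rfl fun i _ => by rw [glue_notMem i.2]

variable {ι : Type} [Fintype ι] [DecidableEq ι] {X : ι → Type} [∀ i, Fintype (X i)]

lemma sum_pi_split {E : Type*} [AddCommMonoid E] (S : Finset ι) (f : (∀ i, X i) → E) :
    ∑ u, f u = ∑ a : ∀ i : {i // i ∈ S}, X i, ∑ b : ∀ i : {i // i ∉ S}, X i,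
      f ((Equiv.piEquivPiSubtypeProd (· ∈ S) X).symm (a, b)) := by
  rw [← (Equiv.piEquivPiSubtypeProd (· ∈ S) X).symm.sum_comp, Fintype.sum_prod_type]

/-- Summing a product over the coordinates outside `S` replaces the factors there by sums. -/
lemma sum_prod_glue (S : Finset ι) (f : ∀ i, X i → ℂ) (a : ∀ i : {i // i ∈ S}, X i) :
    ∑ b : ∀ i : {i // i ∉ S}, X i,
        ∏ i, f i ((Equiv.piEquivPiSubtypeProd (· ∈ S) X).symm (a, b) i) =
      (∏ i : {i // i ∈ S}, f i (a i)) * ∏ i : {i // i ∉ S}, ∑ t, f i t := by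
  simp only [prod_glue, ← Finset.mul_sum]
  rw [Finset.prod_univ_sum, Fintype.piFinset_univ]

lemma marginal_add (S : Finset ι) (M N : Matrix (∀ i, X i) (∀ i, X i) ℂ) :
    marginal S (M + N) = marginal S M + marginal S N := by
  ext; simp [marginal, Finset.sum_add_distrib]

lemma marginal_smul (S : Finset ι) (c : ℂ) (M : Matrix (∀ i, X i) (∀ i, X i) ℂ) :
    marginal S (c • M) = c • marginal S M := by
  ext; simp [marginal, Finset.mul_sum]

/-- Reduction to the systems in `S` as a linear map. -/
def marginalMap (S : Finset ι) : SuperOp (∀ i, X i) (∀ i : {i // i ∈ S}, X i) where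
  toFun := marginal S
  map_add' := marginal_add S
  map_smul' := marginal_smul S

lemma marginal_eq_sum (S : Finset ι) (M : Matrix (∀ i, X i) (∀ i, X i) ℂ) :
    marginal S M = ∑ w : ∀ i : {i // i ∉ S}, X i,
      M.submatrix (fun u => (Equiv.piEquivPiSubtypeProd (· ∈ S) X).symm (u, w))
        (fun u => (Equiv.piEquivPiSubtypeProd (· ∈ S) X).symm (u, w)) := by
  ext; simp [marginal, Matrix.sum_apply]

lemma posSemidef_marginal (S : Finset ι) {M : Matrix (∀ i, X i) (∀ i, X i) ℂ}
    (hM : M.PosSemidef) : (marginal S M).PosSemidef := by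
  rw [marginal_eq_sum]
  exact Matrix.posSemidef_sum _ fun w _ => hM.submatrix _

lemma trace_marginal (S : Finset ι) (M : Matrix (∀ i, X i) (∀ i, X i) ℂ) :
    (marginal S M).trace = M.trace := by
  simp only [Matrix.trace, Matrix.diag_apply, marginal, Matrix.of_apply]
  rw [sum_pi_split S fun u => M u u]

lemma marginal_piTensor (S : Finset ι) (M : ∀ i, Matrix (X i) (X i) ℂ) :
    marginal S (piTensor M) =
      (∏ i : {i // i ∉ S}, (M i).trace) • piTensor fun i : {i // i ∈ S} => M i := by
  ext u v
  simp only [marginal, piTensor, Matrix.of_apply, Matrix.smul_apply, smul_eq_mul]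
  have : ∀ w : ∀ i : {i // i ∉ S}, X i,
      ∏ i, M i ((Equiv.piEquivPiSubtypeProd (· ∈ S) X).symm (u, w) i)
        ((Equiv.piEquivPiSubtypeProd (· ∈ S) X).symm (v, w) i) =
      (∏ i : {i // i ∈ S}, M i (u i) (v i)) * ∏ i : {i // i ∉ S}, M i (w i) (w i) := by
    intro w
    rw [prod_subtype_split S]
    congr 1
    · exact Finset.prod_congr rfl fun i _ => by rw [glue_mem i.2, glue_mem i.2]
    · exact Finset.prod_congr rfl fun i _ => by rw [glue_notMem i.2, glue_notMem i.2]
  simp only [this, ← Finset.mul_sum, Matrix.trace, Matrix.diag_apply]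
  rw [Finset.prod_univ_sum, Fintype.piFinset_univ, mul_comm]

/-- The partial trace is dual to tensoring with the identity. -/
lemma trace_piTensor_mul_of_eq_one [∀ i, DecidableEq (X i)] (S : Finset ι)
    (N : ∀ i, Matrix (X i) (X i) ℂ) (hN : ∀ i, i ∉ S → N i = 1)
    (M : Matrix (∀ i, X i) (∀ i, X i) ℂ) :
    (piTensor N * M).trace =
      (piTensor (fun i : {i // i ∈ S} => N i) * marginal S M).trace := by
  simp only [Matrix.trace, Matrix.diag_apply, Matrix.mul_apply]
  rw [sum_pi_split S fun u => ∑ v, piTensor N u v * M v u]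
  refine Finset.sum_congr rfl fun u _ => ?_
  simp only [marginal, Matrix.of_apply, Finset.mul_sum]
  conv_rhs => rw [Finset.sum_comm]
  refine Finset.sum_congr rfl fun b _ => ?_
  rw [sum_pi_split S fun v => piTensor N _ v * M v _]
  refine Finset.sum_congr rfl fun v _ => ?_
  rw [Finset.sum_eq_single b]
  · congr 1
    simp only [piTensor, Matrix.of_apply]
    rw [prod_subtype_split S]
    have h1 : ∏ i : {i // i ∉ S}, N i ((Equiv.piEquivPiSubtypeProd (· ∈ S) X).symm (u, b) i)
        ((Equiv.piEquivPiSubtypeProd (· ∈ S) X).symm (v, b) i) = 1 :=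
      Finset.prod_eq_one fun i _ => by
        rw [glue_notMem i.2, glue_notMem i.2, hN i i.2, Matrix.one_apply_eq]
    rw [h1, mul_one]
    exact Finset.prod_congr rfl fun i _ => by rw [glue_mem i.2, glue_mem i.2]
  · intro b' _ hb
    obtain ⟨i, hi⟩ := Function.ne_iff.mp hb
    have : piTensor N ((Equiv.piEquivPiSubtypeProd (· ∈ S) X).symm (u, b))
        ((Equiv.piEquivPiSubtypeProd (· ∈ S) X).symm (v, b')) = 0 := by
      simp only [piTensor, Matrix.of_apply]
      refine Finset.prod_eq_zero (Finset.mem_univ i.1) ?_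
      rw [glue_notMem i.2, glue_notMem i.2, hN i i.2, Matrix.one_apply_ne (Ne.symm hi)]
    rw [this, zero_mul]
  · simp

end Marginals

/-! ### Completely positive maps -/

section CompletePositivity

variable {α β γ : Type}

/-- Complete positivity, with an ancilla indexed by an arbitrary finite type. -/
lemma IsCP.block {κ : Type} [Fintype κ] {Φ : SuperOp α β} (hΦ : IsCP Φ)
    {M : Matrix (α × κ) (α × κ) ℂ} (hM : M.PosSemidef) :
    (Matrix.of fun u v : β × κ =>
      Φ (Matrix.of fun p q => M (p, u.2) (q, v.2)) u.1 v.1).PosSemidef := by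
  let e := Fintype.equivFin κ
  have h := (hΦ _ _ (hM.submatrix (Prod.map id e.symm))).submatrix (Prod.map id e)
  convert h using 1
  ext u v
  simp [ampliation]

lemma IsCP.posSemidef {Φ : SuperOp α β} (hΦ : IsCP Φ) {M : Matrix α α ℂ} (hM : M.PosSemidef) :
    (Φ M).PosSemidef :=
  (hΦ.block (κ := Unit) (hM.submatrix Prod.fst)).submatrix fun u => (u, ())

lemma IsCP.comp {Φ : SuperOp α β} {Ψ : SuperOp β γ} (hΨ : IsCP Ψ) (hΦ : IsCP Φ) :
    IsCP (Ψ ∘ₗ Φ) :=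
  fun k M hM => hΨ k _ (hΦ k M hM)

lemma IsCP.add {Φ Ψ : SuperOp α β} (hΦ : IsCP Φ) (hΨ : IsCP Ψ) : IsCP (Φ + Ψ) :=
  fun k M hM => (hΦ k M hM).add (hΨ k M hM)

lemma isCP_zero : IsCP (0 : SuperOp α β) :=
  fun _ _ _ => Matrix.PosSemidef.zero

lemma IsCP.sum {ω : Type*} (s : Finset ω) {Φ : ω → SuperOp α β} (hΦ : ∀ j, IsCP (Φ j)) :
    IsCP (∑ j ∈ s, Φ j) :=
  Finset.sum_induction _ IsCP (fun _ _ => IsCP.add) isCP_zero fun j _ => hΦ j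

lemma IsCP.smul {Φ : SuperOp α β} (hΦ : IsCP Φ) {c : ℂ} (hc : 0 ≤ c) : IsCP (c • Φ) :=
  fun k M hM => (hΦ k M hM).smul hc

/-- The map `M ↦ ∑ₛ Kₛᴴ M Kₛ`, where `Kₛ` relabels basis vectors along `f s`; partial traces
are of this form. -/
def sumSubmatrix {ω : Type} [Fintype ω] (f : ω → β → α) : SuperOp α β where
  toFun M := ∑ s, M.submatrix (f s) (f s)
  map_add' M N := by ext; simp [Matrix.sum_apply, Finset.sum_add_distrib]
  map_smul' c M := by ext; simp [Matrix.sum_apply, Finset.mul_sum]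

lemma sumSubmatrix_apply {ω : Type} [Fintype ω] (f : ω → β → α) (M : Matrix α α ℂ) (u v : β) :
    sumSubmatrix f M u v = ∑ s, M (f s u) (f s v) := by
  simp [sumSubmatrix, Matrix.sum_apply]

lemma isCP_sumSubmatrix {ω : Type} [Fintype ω] (f : ω → β → α) : IsCP (sumSubmatrix f) := by
  intro k M hM
  have : ampliation (sumSubmatrix f) k M =
      ∑ s, M.submatrix (Prod.map (f s) id) (Prod.map (f s) id) := by
    ext u v
    simp only [ampliation, sumSubmatrix_apply, Matrix.sum_apply, Matrix.of_apply]
    rfl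
  rw [this]
  exact Matrix.posSemidef_sum _ fun s _ => hM.submatrix _

/-- Choi's criterion: a map is completely positive if its (unnormalized) Choi matrix is positive. -/
lemma isCP_of_choi [Fintype α] [DecidableEq α] [Fintype β] {Φ : SuperOp α β}
    (h : (Matrix.of fun u v : α × β => Φ (Matrix.single u.1 v.1 1) u.2 v.2).PosSemidef) :
    IsCP Φ := by
  classical
  intro k M hM
  -- `Φ ⊗ id` applied to `M` is a compression of the tensor product of `M` and the Choi matrix.
  set C := Matrix.of fun u v : α × β => Φ (Matrix.single u.1 v.1 1) u.2 v.2 with hC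
  let N : Matrix (α × β × Fin k) (α × β × Fin k) ℂ :=
    (M ⊗ₖ C).submatrix (fun t => ((t.1, t.2.2), (t.1, t.2.1))) fun t => ((t.1, t.2.2), (t.1, t.2.1))
  have hN : N.PosSemidef := (hM.kronecker h).submatrix _
  let W : Matrix (α × β × Fin k) (β × Fin k) ℂ := Matrix.of fun t u => if t.2 = u then 1 else 0
  have : ampliation Φ k M = W.conjTranspose * N * W := by
    ext u v
    simp only [ampliation, Matrix.of_apply]
    rw [superOp_eq_sum Φ]
    simp only [Matrix.sum_apply, Matrix.smul_apply, Matrix.of_apply, smul_eq_mul, Matrix.mul_apply,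
      Matrix.conjTranspose_apply, W, N, Fintype.sum_prod_type (α₁ := α), apply_ite star, star_one,
      star_zero, ite_mul, one_mul, zero_mul, mul_ite, mul_one, mul_zero, Finset.sum_ite_eq',
      Finset.mem_univ, if_true, Matrix.submatrix_apply, Matrix.kroneckerMap_apply, hC]
    exact Finset.sum_comm
  rw [this]
  exact hN.conjTranspose_mul_mul_same W

lemma trace_mul_single [Fintype α] [DecidableEq α] (M : Matrix α α ℂ) (p q : α) :
    (M * Matrix.single p q 1).trace = M q p := by
  rw [Matrix.trace_mul_single]
  simp

/-- The measure-and-prepare map `M ↦ ∑ⱼ Tr(Pⱼ M) ρⱼ`. -/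
def measurePrepare {ω : Type} [Fintype ω] [Fintype α] (P : ω → Matrix α α ℂ)
    (ρ : ω → Matrix β β ℂ) : SuperOp α β where
  toFun M := ∑ j, (P j * M).trace • ρ j
  map_add' M N := by simp [mul_add, add_smul, Finset.sum_add_distrib]
  map_smul' c M := by simp [Finset.smul_sum, mul_smul]

lemma measurePrepare_apply {ω : Type} [Fintype ω] [Fintype α] (P : ω → Matrix α α ℂ)
    (ρ : ω → Matrix β β ℂ) (M : Matrix α α ℂ) :
    measurePrepare P ρ M = ∑ j, (P j * M).trace • ρ j := rfl

lemma isCP_measurePrepare {ω : Type} [Fintype ω] [Fintype α] [DecidableEq α] [Fintype β]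
    {P : ω → Matrix α α ℂ} {ρ : ω → Matrix β β ℂ} (hP : ∀ j, (P j).PosSemidef)
    (hρ : ∀ j, (ρ j).PosSemidef) : IsCP (measurePrepare P ρ) := by
  refine isCP_of_choi ?_
  have : (Matrix.of fun u v : α × β => measurePrepare P ρ (Matrix.single u.1 v.1 1) u.2 v.2) =
      ∑ j, (P j).transpose ⊗ₖ ρ j := by
    ext u v
    simp [measurePrepare_apply, Matrix.sum_apply, trace_mul_single]
  rw [this]
  exact Matrix.posSemidef_sum _ fun j _ => (hP j).transpose.kronecker (hρ j)

lemma isChannel_measurePrepare {ω : Type} [Fintype ω] [Fintype α] [DecidableEq α] [Fintype β]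
    {P : ω → Matrix α α ℂ} {ρ : ω → Matrix β β ℂ} (hP : IsPOVM P) (hρ : ∀ j, IsState (ρ j)) :
    IsChannel (measurePrepare P ρ) := by
  refine ⟨isCP_measurePrepare hP.1 fun j => (hρ j).1, fun M => ?_⟩
  simp only [measurePrepare_apply, Matrix.trace_sum, Matrix.trace_smul, (hρ _).2, smul_eq_mul,
    mul_one]
  rw [← Matrix.trace_sum, ← Finset.sum_mul, hP.2, one_mul]

/-- Two linear maps that agree on all states are equal. -/
lemma superOp_ext_of_state [Fintype α] [DecidableEq α] {Φ Ψ : SuperOp α β}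
    (h : ∀ ρ, IsState ρ → Φ ρ = Ψ ρ) : Φ = Ψ := by
  have hpos : ∀ M : Matrix α α ℂ, M.PosSemidef → Φ M = Ψ M := by
    intro M hM
    by_cases h0 : M.trace = 0
    · rw [hM.trace_eq_zero_iff.mp h0, map_zero, map_zero]
    · have hs : IsState (M.trace⁻¹ • M) :=
        ⟨hM.smul (inv_nonneg.mpr hM.trace_nonneg), by simp [h0]⟩
      have := congrArg (M.trace • ·) (h _ hs)
      simpa [h0] using this
  open scoped MatrixOrder Matrix.Norms.L2Operator in
  have hspan : Submodule.span ℂ {M : Matrix α α ℂ | 0 ≤ M} = ⊤ := CStarAlgebra.span_nonneg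
  refine LinearMap.ext_on hspan fun M hM => hpos M ?_
  open scoped MatrixOrder in
  exact Matrix.nonneg_iff_posSemidef.mp hM

end CompletePositivity

/-! ### Partial traces and the Choi–Jamiołkowski isomorphism -/

section Choi

variable {α β : Type}

lemma traceFst_eq_sumSubmatrix [Fintype α] (M : Matrix (α × β) (α × β) ℂ) :
    traceFst M = sumSubmatrix (fun (s : α) (p : β) => (s, p)) M := by
  ext p q
  simp [traceFst, sumSubmatrix_apply]

lemma trace_traceFst [Fintype α] [Fintype β] (M : Matrix (α × β) (α × β) ℂ) :
    (traceFst M).trace = M.trace := by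
  simp only [Matrix.trace, Matrix.diag_apply, traceFst, Matrix.of_apply,
    Fintype.sum_prod_type (α₁ := α)]
  exact Finset.sum_comm

lemma choiInv_apply [Fintype β] [DecidableEq β] {d : ℕ} (Y : Matrix (β × Fin d) (β × Fin d) ℂ)
    (Z : Matrix (Fin d) (Fin d) ℂ) (u v : β) :
    choiInv Y Z u v = d * ∑ p, ∑ q, Z p q * Y (u, p) (v, q) := by
  simp only [choiInv, LinearMap.coe_mk, AddHom.coe_mk, Matrix.smul_apply, traceSnd, Matrix.of_apply,
    Matrix.mul_apply, Matrix.kroneckerMap_apply, Matrix.one_apply, Matrix.transpose_apply,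
    smul_eq_mul, Fintype.sum_prod_type, ite_mul, one_mul, zero_mul, Finset.sum_ite_irrel,
    Finset.sum_const_zero, Finset.sum_ite_eq, Finset.mem_univ, if_true]
  rw [Finset.sum_comm]

lemma choiInv_sum [Fintype β] [DecidableEq β] {d : ℕ} {ω : Type*} (s : Finset ω)
    (Y : ω → Matrix (β × Fin d) (β × Fin d) ℂ) :
    choiInv (∑ j ∈ s, Y j) = ∑ j ∈ s, choiInv (Y j) := by
  ext Z u v
  simp only [LinearMap.sum_apply, Matrix.sum_apply, choiInv_apply, Finset.mul_sum]
  conv_rhs => rw [Finset.sum_comm]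
  refine Finset.sum_congr rfl fun p _ => ?_
  rw [Finset.sum_comm]

lemma choiInv_smul [Fintype β] [DecidableEq β] {d : ℕ} (c : ℂ)
    (Y : Matrix (β × Fin d) (β × Fin d) ℂ) : choiInv (c • Y) = c • choiInv Y := by
  ext Z u v
  simp only [LinearMap.smul_apply, Matrix.smul_apply, choiInv_apply, Finset.mul_sum, smul_eq_mul]
  refine Finset.sum_congr rfl fun p _ => Finset.sum_congr rfl fun q _ => by ring

lemma isCP_choiInv [Fintype β] [DecidableEq β] {d : ℕ} {Y : Matrix (β × Fin d) (β × Fin d) ℂ}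
    (hY : Y.PosSemidef) : IsCP (choiInv Y) := by
  refine isCP_of_choi ?_
  convert (hY.submatrix Prod.swap).smul (show (0 : ℂ) ≤ d from Nat.cast_nonneg d) using 1
  ext u v
  simp [choiInv_apply, Matrix.single_apply, ite_and, Prod.swap]

lemma trace_choiInv [Fintype β] [DecidableEq β] {d : ℕ} (Y : Matrix (β × Fin d) (β × Fin d) ℂ)
    (Z : Matrix (Fin d) (Fin d) ℂ) :
    (choiInv Y Z).trace = d * ∑ p, ∑ q, Z p q * traceFst Y p q := by
  simp only [Matrix.trace, Matrix.diag_apply, choiInv_apply, traceFst, Matrix.of_apply,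
    ← Finset.mul_sum]
  rw [Finset.sum_comm]
  congr 1
  refine Finset.sum_congr rfl fun p _ => ?_
  rw [Finset.sum_comm]
  exact Finset.sum_congr rfl fun q _ => (Finset.mul_sum _ _ _).symm

/-- `choiInv Y` preserves the trace once the reduced operator of `Y` on the input is `1 / d`. -/
lemma trace_choiInv_of_traceFst [Fintype β] [DecidableEq β] {d : ℕ} (hd : 0 < d)
    {Y : Matrix (β × Fin d) (β × Fin d) ℂ}
    (hY : traceFst Y = (1 / (d : ℂ)) • (1 : Matrix (Fin d) (Fin d) ℂ))
    (Z : Matrix (Fin d) (Fin d) ℂ) : (choiInv Y Z).trace = Z.trace := by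
  have hd' : (d : ℂ) ≠ 0 := by exact_mod_cast hd.ne'
  rw [trace_choiInv, hY, Matrix.trace, Finset.mul_sum]
  refine Finset.sum_congr rfl fun p _ => ?_
  simp only [Matrix.smul_apply, Matrix.one_apply, smul_eq_mul, mul_ite, mul_one, mul_zero,
    Finset.sum_ite_eq, Finset.mem_univ, if_true, Matrix.diag_apply]
  field_simp

/-- The normalized Choi matrix `(1/d) ∑ Λ(E_{pq}) ⊗ E_{pq}` of `Λ`. -/
def choi {d : ℕ} (Λ : SuperOp (Fin d) β) : Matrix (β × Fin d) (β × Fin d) ℂ :=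
  Matrix.of fun u v => (1 / (d : ℂ)) * Λ (Matrix.single u.2 v.2 1) u.1 v.1

lemma choi_sum {d : ℕ} {ω : Type*} (s : Finset ω) (Λ : ω → SuperOp (Fin d) β) :
    choi (∑ j ∈ s, Λ j) = ∑ j ∈ s, choi (Λ j) := by
  ext u v
  simp [choi, Matrix.sum_apply, Finset.mul_sum]

lemma choi_smul {d : ℕ} (c : ℂ) (Λ : SuperOp (Fin d) β) : choi (c • Λ) = c • choi Λ := by
  ext u v
  simp [choi, mul_left_comm]

lemma choiInv_choi [Fintype β] [DecidableEq β] {d : ℕ} (hd : 0 < d) (Λ : SuperOp (Fin d) β) :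
    choiInv (choi Λ) = Λ := by
  have hd' : (d : ℂ) ≠ 0 := by exact_mod_cast hd.ne'
  refine LinearMap.ext fun Z => ?_
  ext u v
  rw [choiInv_apply, superOp_eq_sum Λ Z]
  simp only [choi, Matrix.of_apply, Matrix.sum_apply, Matrix.smul_apply, smul_eq_mul,
    Finset.mul_sum]
  refine Finset.sum_congr rfl fun p _ => Finset.sum_congr rfl fun q _ => ?_
  field_simp

/-- The projector onto the maximally entangled vector, `(1/d) ∑ E_{pq} ⊗ E_{pq}`. -/
def maxEntangled (d : ℕ) : Matrix (Fin d × Fin d) (Fin d × Fin d) ℂ :=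
  Matrix.of fun u v => (1 / (d : ℂ)) * if u.1 = u.2 ∧ v.1 = v.2 then 1 else 0

lemma posSemidef_maxEntangled (d : ℕ) : (maxEntangled d).PosSemidef := by
  have h := (Matrix.posSemidef_vecMulVec_self_star
    (fun u : Fin d × Fin d => if u.1 = u.2 then (1 : ℂ) else 0)).smul
    (show (0 : ℂ) ≤ 1 / (d : ℂ) by positivity)
  convert h using 1
  ext u v
  simp only [maxEntangled, Matrix.of_apply, Matrix.smul_apply, Matrix.vecMulVec_apply, smul_eq_mul,
    Pi.star_apply, apply_ite star, star_one, star_zero, mul_ite, ite_and, mul_one, mul_zero]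
  split_ifs <;> simp

lemma posSemidef_choi {d : ℕ} {Λ : SuperOp (Fin d) β} (hΛ : IsCP Λ) : (choi Λ).PosSemidef := by
  convert hΛ d _ (posSemidef_maxEntangled d) using 1
  ext u v
  have : (Matrix.of fun p q => maxEntangled d (p, u.2) (q, v.2)) =
      (1 / (d : ℂ)) • Matrix.single u.2 v.2 1 := by
    ext p q
    simp [maxEntangled, Matrix.single_apply, eq_comm]
  simp only [ampliation, this, choi, Matrix.of_apply, map_smul, Matrix.smul_apply, smul_eq_mul]

lemma traceFst_choi [Fintype β] {d : ℕ} {Λ : SuperOp (Fin d) β} (hΛ : ∀ M, (Λ M).trace = M.trace) :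
    traceFst (choi Λ) = (1 / (d : ℂ)) • (1 : Matrix (Fin d) (Fin d) ℂ) := by
  ext p q
  have h := hΛ (Matrix.single p q 1)
  simp only [traceFst, choi, Matrix.of_apply, ← Finset.mul_sum, Matrix.smul_apply, smul_eq_mul]
  congr 1
  refine h.trans ?_
  by_cases hpq : p = q
  · subst hpq; simp
  · rw [Matrix.trace_single_eq_of_ne _ _ _ hpq, Matrix.one_apply_ne hpq]

lemma trace_choi [Fintype β] {d : ℕ} (hd : 0 < d) {Λ : SuperOp (Fin d) β}
    (hΛ : ∀ M, (Λ M).trace = M.trace) : (choi Λ).trace = 1 := by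
  have hd' : (d : ℂ) ≠ 0 := by exact_mod_cast hd.ne'
  rw [← trace_traceFst, traceFst_choi hΛ, Matrix.trace_smul, Matrix.trace_one]
  simp [hd']

end Choi

/-! ### Rank-one projectors of an orthonormal basis -/

section Ketbra

variable {α : Type}

lemma posSemidef_ketbra [Finite α] (v : EuclideanSpace ℂ α) : (ketbra v).PosSemidef :=
  Matrix.posSemidef_vecMulVec_self_star (fun p => v p)

lemma trace_ketbra [Fintype α] {v : EuclideanSpace ℂ α} (hv : ‖v‖ = 1) : (ketbra v).trace = 1 := by
  have h := EuclideanSpace.norm_sq_eq v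
  rw [hv] at h
  simp only [Matrix.trace, Matrix.diag_apply, ketbra, Matrix.of_apply, RCLike.star_def,
    Complex.mul_conj, Complex.normSq_eq_norm_sq]
  rw [← Complex.ofReal_sum, ← h]
  simp

lemma sum_ketbra [Fintype α] [DecidableEq α] (e : OrthonormalBasis α ℂ (EuclideanSpace ℂ α)) :
    ∑ a, ketbra (e a) = 1 := by
  ext p q
  have h := e.sum_inner_mul_inner (EuclideanSpace.single p 1) (EuclideanSpace.single q (1 : ℂ))
  simp only [EuclideanSpace.inner_single_left, EuclideanSpace.inner_single_right, map_one, one_mul,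
    PiLp.single_apply] at h
  simp only [Matrix.sum_apply, ketbra, Matrix.of_apply]
  refine h.trans ?_
  rw [apply_ite (starRingEnd ℂ), map_one, map_zero, Matrix.one_apply]
  simp only [eq_comm]

lemma isPOVM_ketbra [Fintype α] [DecidableEq α]
    (e : OrthonormalBasis α ℂ (EuclideanSpace ℂ α)) : IsPOVM fun a => ketbra (e a) :=
  ⟨fun _ => posSemidef_ketbra _, sum_ketbra e⟩

lemma ketbra_basisFun [Fintype α] [DecidableEq α] (a : α) :
    ketbra (EuclideanSpace.basisFun α ℂ a) = Matrix.single a a 1 := by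
  ext p q
  simp only [ketbra, Matrix.of_apply, EuclideanSpace.basisFun_apply, Matrix.single_apply,
    PiLp.single_apply, eq_comm (a := a)]
  split_ifs <;> simp_all

end Ketbra

/-! ### The `n` untrusted parties and the last party -/

section Join

variable {n : ℕ} {d : Fin n → ℕ} {T : Type}

/-- The family of operators whose tensor product is `joinOp M N`. -/
def joinFam (M : ∀ i, Matrix (Fin (d i)) (Fin (d i)) ℂ) (N : Matrix T T ℂ) :
    ∀ o, Matrix (Sys d T o) (Sys d T o) ℂ
  | none => N
  | some i => M i

lemma joinOp_eq (M : ∀ i, Matrix (Fin (d i)) (Fin (d i)) ℂ) (N : Matrix T T ℂ) :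
    joinOp M N = piTensor (joinFam M N) :=
  congrArg piTensor (funext fun o => by cases o <;> rfl)

/-- The element of `∀ o, R o` with last entry `l` and other entries `s`. -/
def optJoin {R : Option (Fin n) → Type} (s : ∀ i, R (some i)) (l : R none) : ∀ o, R o
  | none => l
  | some i => s i

lemma sum_optJoin {R : Option (Fin n) → Type} [∀ o, Fintype (R o)] {E : Type*} [AddCommMonoid E]
    (f : (∀ o, R o) → E) : ∑ u, f u = ∑ s : ∀ i, R (some i), ∑ l, f (optJoin s l) := by
  rw [← (Equiv.piOptionEquivProd (β := R)).symm.sum_comp, Fintype.sum_prod_type, Finset.sum_comm]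
  refine Finset.sum_congr rfl fun s _ => Finset.sum_congr rfl fun l _ => congrArg f ?_
  funext o
  cases o <;> rfl

lemma joinIdx_eq (a : ∀ i, Fin (d i)) (t : T) : joinIdx a t = optJoin (R := Sys d T) a t := by
  funext o
  cases o <;> rfl

lemma sum_joinIdx [Fintype T] {E : Type*} [AddCommMonoid E] (f : (∀ o, Sys d T o) → E) :
    ∑ u, f u = ∑ a : ∀ i, Fin (d i), ∑ t : T, f (joinIdx a t) := by
  simp only [joinIdx_eq]
  exact sum_optJoin f

lemma joinOp_apply (M : ∀ i, Matrix (Fin (d i)) (Fin (d i)) ℂ) (N : Matrix T T ℂ)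
    (a b : ∀ i, Fin (d i)) (s t : T) :
    joinOp M N (joinIdx a s) (joinIdx b t) = N s t * ∏ i, M i (a i) (b i) := by
  rw [joinOp_eq, piTensor, Matrix.of_apply, Fintype.prod_option]
  rfl

lemma piTensor_joinFam_apply (M : ∀ i, Matrix (Fin (d i)) (Fin (d i)) ℂ) (N : Matrix T T ℂ)
    (u v : ∀ o, Sys d T o) :
    piTensor (joinFam M N) u v = N (u none) (v none) * ∏ i, M i (u (some i)) (v (some i)) := by
  rw [piTensor, Matrix.of_apply, Fintype.prod_option]
  rfl

lemma sum_joinOp {ω : Fin n → Type} [∀ i, Fintype (ω i)]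
    (B : ∀ i, ω i → Matrix (Fin (d i)) (Fin (d i)) ℂ) (N : Matrix T T ℂ) :
    ∑ a : ∀ i, ω i, joinOp (fun i => B i (a i)) N = joinOp (fun i => ∑ b, B i b) N := by
  have key : ∀ s t : ∀ i, Fin (d i),
      ∑ a : ∀ i, ω i, ∏ i, B i (a i) (s i) (t i) = ∏ i, (∑ b, B i b) (s i) (t i) := by
    intro s t
    simp only [Matrix.sum_apply]
    rw [Finset.prod_univ_sum, Fintype.piFinset_univ]
  simp only [joinOp_eq]
  ext u v
  rw [piTensor_joinFam_apply, Matrix.sum_apply,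
    Finset.sum_congr rfl fun a _ => piTensor_joinFam_apply (fun i => B i (a i)) N u v,
    ← Finset.mul_sum]
  exact congrArg _ (key (fun i => u (some i)) fun i => v (some i))

lemma joinOp_mul_joinOp [Fintype T] (M M' : ∀ i, Matrix (Fin (d i)) (Fin (d i)) ℂ)
    (N N' : Matrix T T ℂ) :
    joinOp M N * joinOp M' N' = joinOp (fun i => M i * M' i) (N * N') := by
  simp only [joinOp_eq, piTensor_mul]
  exact congrArg piTensor (funext fun o => by cases o <;> rfl)

lemma trace_joinOp [Fintype T] (M : ∀ i, Matrix (Fin (d i)) (Fin (d i)) ℂ) (N : Matrix T T ℂ) :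
    (joinOp M N).trace = N.trace * ∏ i, (M i).trace := by
  rw [joinOp_eq, trace_piTensor, Fintype.prod_option]
  rfl

lemma traceParties_sum {ω : Type*} (s : Finset ω)
    (M : ω → Matrix (∀ o, Sys d T o) (∀ o, Sys d T o) ℂ) :
    traceParties (∑ j ∈ s, M j) = ∑ j ∈ s, traceParties (M j) := by
  ext p q
  simp only [traceParties, Matrix.of_apply, Matrix.sum_apply]
  exact Finset.sum_comm

lemma traceParties_smul (c : ℂ) (M : Matrix (∀ o, Sys d T o) (∀ o, Sys d T o) ℂ) :
    traceParties (c • M) = c • traceParties M := by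
  ext p q
  simp [traceParties, Finset.mul_sum]

lemma joinOp_one_one [DecidableEq T] :
    joinOp (fun i => (1 : Matrix (Fin (d i)) (Fin (d i)) ℂ)) (1 : Matrix T T ℂ) = 1 := by
  rw [joinOp_eq, ← piTensor_one]
  exact congrArg piTensor (funext fun o => by cases o <;> rfl)

variable [Fintype T] [DecidableEq T]

/-- The entries of `Tr_{A₁…Aₙ}[(M ⊗ 1) D]` are expectations of product operators. -/
lemma traceParties_joinOp_mul_apply (M : ∀ i, Matrix (Fin (d i)) (Fin (d i)) ℂ)
    (D : Matrix (∀ o, Sys d T o) (∀ o, Sys d T o) ℂ) (p q : T) :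
    traceParties (joinOp M (1 : Matrix T T ℂ) * D) p q =
      (joinOp M (Matrix.single q p 1) * D).trace := by
  simp only [traceParties, Matrix.trace, Matrix.diag_apply, Matrix.of_apply, Matrix.mul_apply]
  rw [sum_joinIdx fun u => ∑ v, joinOp M (Matrix.single q p 1) u v * D v u]
  refine Finset.sum_congr rfl fun a _ => ?_
  rw [Finset.sum_eq_single q]
  · rw [sum_joinIdx fun v => joinOp M 1 _ v * D v _, sum_joinIdx fun v => joinOp M _ _ v * D v _]
    refine Finset.sum_congr rfl fun b _ => ?_
    simp only [joinOp_apply]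
    rw [Finset.sum_eq_single p, Finset.sum_eq_single p]
    · simp
    · intro t _ ht; simp [ht.symm]
    · simp
    · intro t _ ht; simp [ht.symm]
    · simp
  · intro t _ ht
    rw [sum_joinIdx fun v => joinOp M _ _ v * D v _]
    refine Finset.sum_eq_zero fun b _ => Finset.sum_eq_zero fun t' _ => ?_
    simp [joinOp_apply, ht.symm]
  · simp

lemma traceParties_joinOp_mul_joinOp (M M' : ∀ i, Matrix (Fin (d i)) (Fin (d i)) ℂ)
    (N : Matrix T T ℂ) :
    traceParties (joinOp M (1 : Matrix T T ℂ) * joinOp M' N) =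
      (∏ i, (M i * M' i).trace) • N := by
  ext p q
  rw [traceParties_joinOp_mul_apply, joinOp_mul_joinOp, trace_joinOp, Matrix.trace_mul_comm,
    trace_mul_single, Matrix.smul_apply, smul_eq_mul, mul_comm]

end Join

/-! ### The Heisenberg picture of a channel -/

section Heisenberg

variable {α β ρ : Type}

lemma isCP_kroneckerLeft [Fintype α] [Fintype ρ] {M : Matrix α α ℂ} (hM : M.PosSemidef) :
    IsCP (fixFst (LinearMap.id : SuperOp (α × ρ) (α × ρ)) M) := by
  intro k N hN
  classical
  exact (hM.kronecker hN).submatrix fun u : (α × ρ) × Fin k => (u.1.1, (u.1.2, u.2))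

lemma isCP_fixFst [Fintype α] [Fintype ρ] {T : SuperOp (α × ρ) β} (hT : IsCP T)
    {M : Matrix α α ℂ} (hM : M.PosSemidef) : IsCP (fixFst T M) :=
  hT.comp (isCP_kroneckerLeft hM)

lemma isChannel_fixFst [Fintype α] [Fintype ρ] [Fintype β] {T : SuperOp (α × ρ) β}
    (hT : IsChannel T) {M : Matrix α α ℂ} (hM : IsState M) : IsChannel (fixFst T M) :=
  ⟨isCP_fixFst hT.1 hM.1, fun N => by
    rw [fixFst_apply, hT.2, Matrix.trace_kronecker, hM.2, one_mul]⟩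

/-- The operator `T†(A)`, characterized by `Tr[T†(A) N] = Tr[A T(N)]`. -/
def dualOp [DecidableEq ρ] [Fintype β] (T : SuperOp ρ β) (A : Matrix β β ℂ) : Matrix ρ ρ ℂ :=
  Matrix.of fun s t => (A * T (Matrix.single t s 1)).trace

lemma trace_dualOp_mul [Fintype ρ] [DecidableEq ρ] [Fintype β] (T : SuperOp ρ β)
    (A : Matrix β β ℂ) (N : Matrix ρ ρ ℂ) : (dualOp T A * N).trace = (A * T N).trace := by
  rw [superOp_eq_sum T N]
  simp only [Finset.mul_sum, Matrix.mul_smul, Matrix.trace_sum, Matrix.trace_smul, smul_eq_mul]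
  rw [Matrix.trace, Finset.sum_comm]
  simp only [Matrix.diag_apply, Matrix.mul_apply, dualOp, Matrix.of_apply]
  exact Finset.sum_congr rfl fun s _ => Finset.sum_congr rfl fun t _ => mul_comm _ _

lemma trace_mul_nonneg [Fintype α] {A B : Matrix α α ℂ} (hA : A.PosSemidef) (hB : B.PosSemidef) :
    0 ≤ (A * B).trace := by
  classical
  have h : ∃ C : Matrix α α ℂ, A = C.conjTranspose * C := by
    open scoped MatrixOrder in
    exact CStarAlgebra.nonneg_iff_eq_star_mul_self.mp (Matrix.nonneg_iff_posSemidef.mpr hA)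
  obtain ⟨C, rfl⟩ := h
  rw [mul_assoc, Matrix.trace_mul_comm]
  exact (hB.mul_mul_conjTranspose_same C).trace_nonneg

lemma posSemidef_dualOp [Fintype ρ] [DecidableEq ρ] [Fintype β] {T : SuperOp ρ β} (hT : IsCP T)
    {A : Matrix β β ℂ} (hA : A.PosSemidef) : (dualOp T A).PosSemidef := by
  -- Over `ℂ` nonnegative expectation values suffice, and `⟨x, T†(A) x⟩ = Tr[A T(|x⟩⟨x|)]`.
  rw [← Matrix.isPositive_toEuclideanLin_iff, LinearMap.isPositive_iff_complex]
  intro x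
  have h := trace_mul_nonneg hA
    (hT.posSemidef (Matrix.posSemidef_vecMulVec_self_star (fun s => x s)))
  rw [← trace_dualOp_mul] at h
  have hx : inner ℂ (Matrix.toEuclideanLin (dualOp T A) x) x =
      star (dualOp T A * Matrix.vecMulVec (fun s => x s) (star fun s => x s)).trace := by
    simp only [Matrix.trace, Matrix.diag_apply, Matrix.mul_apply, Matrix.vecMulVec_apply]
    simp only [EuclideanSpace.inner_eq_star_dotProduct, dotProduct, Matrix.ofLp_toLpLin,
      Matrix.toLin'_apply, Matrix.mulVec, star_sum, Finset.mul_sum, Pi.star_apply, star_mul',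
      star_star]
    refine Finset.sum_congr rfl fun s _ => Finset.sum_congr rfl fun t _ => ?_
    ring
  rw [hx]
  have hs : star (dualOp T A * Matrix.vecMulVec (fun s => x s) (star fun s => x s)).trace =
      (dualOp T A * Matrix.vecMulVec (fun s => x s) (star fun s => x s)).trace :=
    (IsSelfAdjoint.of_nonneg h).star_eq
  rw [hs]
  obtain ⟨h1, h2⟩ := Complex.nonneg_iff.mp h
  exact ⟨Complex.ext rfl h2, h1⟩

lemma isPOVM_dualOp {ω : Type} [Fintype ω] [Fintype ρ] [DecidableEq ρ] [Fintype β] [DecidableEq β]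
    {T : SuperOp ρ β} (hT : IsChannel T) {A : ω → Matrix β β ℂ} (hA : IsPOVM A) :
    IsPOVM fun a => dualOp T (A a) := by
  refine ⟨fun a => posSemidef_dualOp hT.1 (hA.1 a), ?_⟩
  ext s t
  simp only [Matrix.sum_apply, dualOp, Matrix.of_apply]
  rw [← Matrix.trace_sum, ← Finset.sum_mul, hA.2, one_mul, hT.2]
  by_cases h : s = t
  · subst h; simp
  · rw [Matrix.trace_single_eq_of_ne _ _ _ (Ne.symm h), Matrix.one_apply_ne h]

end Heisenberg

section LocalMaps

variable {n : ℕ} {k : Fin n → ℕ} {T : Type} {R : Option (Fin n) → Type}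

/-- The family of local maps `M i` of the untrusted parties and `N` of the last party. -/
def joinMap (M : ∀ i, SuperOp (R (some i)) (Fin (k i))) (N : SuperOp (R none) T) :
    ∀ o, SuperOp (R o) (Sys k T o)
  | none => N
  | some i => M i

/-- The map `id ⊗ Ψ`, where `Ψ` acts on the last of the `n + 1` systems. -/
def applyLast (Ψ : SuperOp (R none) T) (σ : Matrix (∀ o, R o) (∀ o, R o) ℂ) :
    Matrix ((∀ i, R (some i)) × T) ((∀ i, R (some i)) × T) ℂ :=
  Matrix.of fun u v => Ψ (Matrix.of fun l l' => σ (optJoin u.1 l) (optJoin v.1 l')) u.2 v.2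

variable [∀ o, Fintype (R o)]

lemma posSemidef_applyLast {Ψ : SuperOp (R none) T} (hΨ : IsCP Ψ)
    {σ : Matrix (∀ o, R o) (∀ o, R o) ℂ} (hσ : σ.PosSemidef) : (applyLast Ψ σ).PosSemidef :=
  (hΨ.block (hσ.submatrix fun u : R none × (∀ i, R (some i)) => optJoin u.2 u.1)).submatrix
    Prod.swap

variable [∀ o, DecidableEq (R o)]

lemma tensorMap_joinMap_apply (Ψ : ∀ i, SuperOp (R (some i)) (Fin (k i)))
    (Ψ₀ : SuperOp (R none) T) (σ : Matrix (∀ o, R o) (∀ o, R o) ℂ) :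
    tensorMap (joinMap Ψ Ψ₀) σ = ∑ u, ∑ v, σ u v •
      joinOp (fun i => Ψ i (Matrix.single (u (some i)) (v (some i)) 1))
        (Ψ₀ (Matrix.single (u none) (v none) 1)) := by
  rw [tensorMap_apply]
  refine Finset.sum_congr rfl fun u _ => Finset.sum_congr rfl fun v _ => ?_
  rw [joinOp_eq]
  exact congrArg (σ u v • piTensor ·) (funext fun o => by cases o <;> rfl)

/-- Effects `M i` measured after the local maps `Ψ i` act as the effects `Ψ i†(M i)` on the
shared state. -/
lemma traceParties_joinOp_mul_tensorMap [Fintype T] [DecidableEq T]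
    (M : ∀ i, Matrix (Fin (k i)) (Fin (k i)) ℂ)
    (Ψ : ∀ i, SuperOp (R (some i)) (Fin (k i))) (Ψ₀ : SuperOp (R none) T)
    (σ : Matrix (∀ o, R o) (∀ o, R o) ℂ) :
    traceParties (joinOp M (1 : Matrix T T ℂ) * tensorMap (joinMap Ψ Ψ₀) σ) =
      traceFst ((piTensor (fun i => dualOp (Ψ i) (M i)) ⊗ₖ (1 : Matrix T T ℂ)) *
        applyLast Ψ₀ σ) := by
  have hL : traceParties (joinOp M (1 : Matrix T T ℂ) * tensorMap (joinMap Ψ Ψ₀) σ) =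
      ∑ u, ∑ v, σ u v •
        ((∏ i, (M i * Ψ i (Matrix.single (u (some i)) (v (some i)) 1)).trace) •
          Ψ₀ (Matrix.single (u none) (v none) 1)) := by
    simp only [tensorMap_joinMap_apply, Finset.mul_sum, Matrix.mul_smul, traceParties_sum,
      traceParties_smul, traceParties_joinOp_mul_joinOp]
  rw [hL]
  ext p q
  have hR : ∀ s s' : ∀ i, R (some i), applyLast Ψ₀ σ (s', p) (s, q) =
      ∑ l, ∑ l', σ (optJoin s' l) (optJoin s l') * Ψ₀ (Matrix.single l l' 1) p q := by
    intro s s'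
    rw [applyLast, Matrix.of_apply, superOp_eq_sum Ψ₀]
    simp [Matrix.sum_apply]
  simp only [Matrix.sum_apply, Matrix.smul_apply, smul_eq_mul, traceFst, Matrix.of_apply,
    Matrix.mul_apply, Fintype.sum_prod_type, Matrix.kroneckerMap_apply, Matrix.one_apply, mul_ite,
    mul_one, mul_zero, ite_mul, zero_mul, Finset.sum_ite_eq, Finset.mem_univ, if_true, hR]
  simp only [sum_optJoin (R := R), optJoin]
  conv_rhs => rw [Finset.sum_comm]
  refine Finset.sum_congr rfl fun s' _ => ?_
  rw [Finset.sum_comm]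
  refine Finset.sum_congr rfl fun s _ => ?_
  simp only [Finset.mul_sum]
  refine Finset.sum_congr rfl fun l _ => Finset.sum_congr rfl fun l' _ => ?_
  simp only [piTensor, dualOp, Matrix.of_apply]
  ring

end LocalMaps

/-! ### Reconstructing the assemblage from its Choi matrices -/

section Generation

variable {n : ℕ} {m k : Fin n → ℕ} {dC dC' dY : ℕ}

lemma sum_traceParties_joinOp_mul {ω : Fin n → Type} [∀ i, Fintype (ω i)]
    {B : ∀ i, ω i → Matrix (Fin (k i)) (Fin (k i)) ℂ} (hB : ∀ i, ∑ b, B i b = 1)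
    {T : Type} [Fintype T] [DecidableEq T] (D : Matrix (∀ o, Sys k T o) (∀ o, Sys k T o) ℂ) :
    ∑ a : ∀ i, ω i, traceParties (joinOp (fun i => B i (a i)) (1 : Matrix T T ℂ) * D) =
      traceParties D := by
  rw [← traceParties_sum, ← Finset.sum_mul, sum_joinOp]
  simp only [hB, joinOp_one_one, one_mul]

/-- In the standard bases, `Φ` generates `Λ` if the conditional outputs of `Φ` are the Choi
matrices of `Λ`. -/
lemma generates_of_choi (hC : 0 < dC) {Λ : Family m k dC dC'}
    {Φ : SuperOp (∀ o, Sys m (Fin dY) o) (∀ o, Sys k (Fin dC' × Fin dC) o)}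
    {y : EuclideanSpace ℂ (Fin dY)}
    (hΛ : ∀ (x : ∀ i, Fin (m i)) M, ((∑ a, Λ a x) M).trace = M.trace)
    (h : ∀ a (x : ∀ i, Fin (m i)), traceParties
      (joinOp (fun i => Matrix.single (a i) (a i) 1)
        (1 : Matrix (Fin dC' × Fin dC) (Fin dC' × Fin dC) ℂ) *
        Φ (joinOp (fun i => Matrix.single (x i) (x i) 1) (ketbra y))) = choi (Λ a x)) :
    Generates Φ (fun _ => EuclideanSpace.basisFun _ ℂ) (fun _ => EuclideanSpace.basisFun _ ℂ)
      y Λ := by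
  simp only [Generates, ketbra_basisFun, h, choiInv_choi hC, true_and, implies_true]
  intro x
  rw [← sum_traceParties_joinOp_mul (B := fun i a => Matrix.single a a 1)]
  · simp only [h]
    rw [← choi_sum, traceFst_choi (hΛ x)]
  · intro i
    ext p q
    simp [Matrix.sum_apply, Matrix.single_apply, Matrix.one_apply, ite_and]

end Generation

/-! ### No-signaling assemblages and causal channels -/

section Causal

lemma isPOVM_single {α : Type} [Fintype α] [DecidableEq α] :
    IsPOVM fun u : α => Matrix.single u u (1 : ℂ) := by
  simpa only [ketbra_basisFun] using isPOVM_ketbra (EuclideanSpace.basisFun α ℂ)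

lemma trace_single_mul {α : Type} [Fintype α] [DecidableEq α] (M : Matrix α α ℂ) (p q : α) :
    (Matrix.single p q 1 * M).trace = M q p := by
  rw [Matrix.trace_mul_comm, trace_mul_single]

variable {ι : Type} [Fintype ι] [DecidableEq ι] {X A : ι → Type}
  [∀ i, Fintype (X i)] [∀ i, DecidableEq (X i)] [∀ i, Fintype (A i)]

/-- Reduced operators on `S` are determined by the product observables supported on `S`. -/
lemma marginal_ext {S : Finset ι} {M N : Matrix (∀ i, X i) (∀ i, X i) ℂ}
    (h : ∀ B : ∀ i, Matrix (X i) (X i) ℂ, (∀ i, i ∉ S → B i = 1) →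
      (piTensor B * M).trace = (piTensor B * N).trace) : marginal S M = marginal S N := by
  ext u v
  let B : ∀ i, Matrix (X i) (X i) ℂ := fun i =>
    if hi : i ∈ S then Matrix.single (v ⟨i, hi⟩) (u ⟨i, hi⟩) 1 else 1
  have hB : ∀ i, i ∉ S → B i = 1 := fun i hi => dif_neg hi
  have hB' : (piTensor fun i : {i // i ∈ S} => B i) = Matrix.single v u 1 := by
    rw [← piTensor_single]
    exact congrArg piTensor (funext fun i => dif_pos i.2)
  have := h B hB
  rwa [trace_piTensor_mul_of_eq_one S B hB, trace_piTensor_mul_of_eq_one S B hB, hB',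
    trace_single_mul, trace_single_mul] at this

/-- The channel that measures its input in the product basis and, on the result `u`, prepares the
state `R u`, is causal if the reduced states of `R` are no-signaling. -/
lemma isCausal_measurePrepare [∀ i, Nonempty (X i)]
    {R : (∀ i, X i) → Matrix (∀ i, A i) (∀ i, A i) ℂ} (hR : ∀ u, IsState (R u))
    (hS : ∀ (S : Finset ι) (u v : ∀ i, X i), (∀ i ∈ S, u i = v i) →
      marginal S (R u) = marginal S (R v)) :
    IsCausal (measurePrepare (fun u => Matrix.single u u 1) R) := by
  refine ⟨isChannel_measurePrepare isPOVM_single hR, fun S => ?_⟩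
  let b₀ : ∀ i : {i // i ∉ S}, X i := fun i => Classical.arbitrary _
  refine ⟨measurePrepare (fun a => Matrix.single a a 1) fun a =>
    marginal S (R ((Equiv.piEquivPiSubtypeProd (· ∈ S) X).symm (a, b₀))),
    isChannel_measurePrepare isPOVM_single fun a =>
      ⟨posSemidef_marginal S (hR _).1, by rw [trace_marginal, (hR _).2]⟩, fun M => ?_⟩
  simp only [measurePrepare_apply, trace_single_mul]
  have h1 : marginal S (∑ u, M u u • R u) = ∑ u, M u u • marginal S (R u) := by
    change marginalMap S _ = _
    simp only [map_sum, map_smul]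
    rfl
  rw [h1, sum_pi_split S]
  refine Finset.sum_congr rfl fun a _ => ?_
  simp only [marginal, Matrix.of_apply, Finset.sum_smul]
  refine Finset.sum_congr rfl fun b _ => congrArg _ ?_
  refine hS S _ _ fun i hi => ?_
  rw [glue_mem hi, glue_mem hi]

end Causal

section NoSignaling

variable {n : ℕ} {m k : Fin n → ℕ} {dC dC' dY : ℕ}

/-- Weighted sums over outcomes with product weights supported on `I` depend only on the settings
of the parties in `I`. -/
lemma IsNSAssemblage.sum_smul_eq {Λ : Family m k dC dC'} (hΛ : IsNSAssemblage Λ)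
    (I : Finset (Fin n)) {x x' : ∀ i, Fin (m i)} (hx : ∀ i ∈ I, x i = x' i)
    {c : ∀ i, Fin (k i) → ℂ} (hc : ∀ i, i ∉ I → ∀ b, c i b = 1) :
    ∑ a, (∏ i, c i (a i)) • Λ a x = ∑ a, (∏ i, c i (a i)) • Λ a x' := by
  obtain ⟨-, ⟨Λ₀, -, h₀⟩, hI⟩ := hΛ
  -- The definition treats `I = ∅` in a separate clause and leaves out `I = univ`.
  rcases I.eq_empty_or_nonempty with rfl | hne
  · have : ∀ a : ∀ i, Fin (k i), ∏ i, c i (a i) = 1 := fun a =>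
      Finset.prod_eq_one fun i _ => hc i (Finset.notMem_empty i) _
    simp only [this, one_smul, h₀]
  by_cases huniv : I = Finset.univ
  · rw [show x = x' from funext fun i => hx i (huniv ▸ Finset.mem_univ i)]
  obtain ⟨L, hL⟩ := hI I hne huniv
  have key : ∀ x, ∑ a, (∏ i, c i (a i)) • Λ a x =
      ∑ a : ∀ i : {i // i ∈ I}, Fin (k i), (∏ i : {i // i ∈ I}, c i (a i)) • L a fun i => x i := by
    intro x
    rw [sum_pi_split I]
    refine Finset.sum_congr rfl fun a _ => ?_
    rw [← hL, Finset.smul_sum]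
    refine Finset.sum_congr rfl fun b _ => ?_
    rw [prod_glue I c, Finset.prod_eq_one fun (i : {i // i ∉ I}) _ => hc i i.2 _, mul_one]
  rw [key, key, show (fun i : {i // i ∈ I} => x i) =
    fun i : {i // i ∈ I} => x' i from funext fun i => hx i i.2]

lemma posSemidef_joinOp {d : Fin n → ℕ} {T : Type} [Fintype T]
    {M : ∀ i, Matrix (Fin (d i)) (Fin (d i)) ℂ} {N : Matrix T T ℂ} (hM : ∀ i, (M i).PosSemidef)
    (hN : N.PosSemidef) : (joinOp M N).PosSemidef := by
  rw [joinOp_eq]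
  refine posSemidef_piTensor fun o => ?_
  cases o
  · exact hN
  · exact hM _

/-- The state `∑ₐ |a⟩⟨a| ⊗ J(Λ_{a|x})`. -/
def outputState (Λ : Family m k dC dC') (x : ∀ i, Fin (m i)) :
    Matrix (∀ o, Sys k (Fin dC' × Fin dC) o) (∀ o, Sys k (Fin dC' × Fin dC) o) ℂ :=
  ∑ a, joinOp (fun i => Matrix.single (a i) (a i) 1) (choi (Λ a x))

lemma isState_outputState (hC : 0 < dC) {Λ : Family m k dC dC'} (hΛ : IsNSAssemblage Λ)
    (x : ∀ i, Fin (m i)) : IsState (outputState Λ x) := by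
  obtain ⟨hcp, ⟨Λ₀, hch, h₀⟩, -⟩ := hΛ
  refine ⟨Matrix.posSemidef_sum _ fun a _ => posSemidef_joinOp (fun i => isPOVM_single.1 _)
    (posSemidef_choi (hcp a x)), ?_⟩
  simp only [outputState, Matrix.trace_sum, trace_joinOp, Matrix.trace_single_eq_same,
    Finset.prod_const_one, mul_one]
  rw [← Matrix.trace_sum, ← choi_sum, h₀, trace_choi hC hch.2]

lemma trace_joinOp_mul_outputState (Λ : Family m k dC dC') (x : ∀ i, Fin (m i))
    (M : ∀ i, Matrix (Fin (k i)) (Fin (k i)) ℂ)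
    (N : Matrix (Fin dC' × Fin dC) (Fin dC' × Fin dC) ℂ) :
    (joinOp M N * outputState Λ x).trace =
      (N * choi (∑ a, (∏ i, M i (a i) (a i)) • Λ a x)).trace := by
  simp only [outputState, Finset.mul_sum, Matrix.trace_sum, joinOp_mul_joinOp, trace_joinOp,
    trace_mul_single, choi_sum, choi_smul, Matrix.mul_smul, Matrix.trace_smul, smul_eq_mul]
  exact Finset.sum_congr rfl fun a _ => mul_comm _ _

lemma exists_eq_joinFam {d : Fin n → ℕ} {T : Type} (B : ∀ o, Matrix (Sys d T o) (Sys d T o) ℂ) :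
    ∃ M N, B = joinFam M N :=
  ⟨fun i => B (some i), B none, funext fun o => by cases o <;> rfl⟩

lemma marginal_outputState {Λ : Family m k dC dC'} (hΛ : IsNSAssemblage Λ)
    (S : Finset (Option (Fin n))) {x x' : ∀ i, Fin (m i)}
    (hx : ∀ i, some i ∈ S → x i = x' i) :
    marginal S (outputState Λ x) = marginal S (outputState Λ x') := by
  refine marginal_ext fun B hB => ?_
  obtain ⟨M, N, rfl⟩ := exists_eq_joinFam B
  rw [← joinOp_eq, trace_joinOp_mul_outputState, trace_joinOp_mul_outputState,
    hΛ.sum_smul_eq (Finset.eraseNone S) (x' := x') (c := fun i a => M i a a)]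
  · intro i hi
    exact hx i (Finset.mem_eraseNone.mp hi)
  · intro i hi b
    have hM : M i = 1 := hB (some i) fun h => hi (Finset.mem_eraseNone.mpr h)
    rw [hM, Matrix.one_apply_eq]

theorem IsNSAssemblage.exists_isCausal (hm : ∀ i, 0 < m i) (hC : 0 < dC)
    {y : EuclideanSpace ℂ (Fin dY)} (hy : ‖y‖ = 1) {Λ : Family m k dC dC'}
    (hΛ : IsNSAssemblage Λ) :
    ∃ (Φ : SuperOp (∀ o, Sys m (Fin dY) o) (∀ o, Sys k (Fin dC' × Fin dC) o))
      (eA : ∀ i, OrthonormalBasis (Fin (k i)) ℂ (EuclideanSpace ℂ (Fin (k i))))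
      (eX : ∀ i, OrthonormalBasis (Fin (m i)) ℂ (EuclideanSpace ℂ (Fin (m i)))),
      IsCausal Φ ∧ Generates Φ eA eX y Λ := by
  have hdY : Nonempty (Fin dY) := by
    by_contra h
    rw [not_nonempty_iff] at h
    rw [Subsingleton.elim y 0, norm_zero] at hy
    exact zero_ne_one hy
  have hne : ∀ o, Nonempty (Sys m (Fin dY) o)
    | none => hdY
    | some i => ⟨(⟨0, hm i⟩ : Fin (m i))⟩
  obtain ⟨Λ₀, hch, h₀⟩ := hΛ.2.1
  let Φ : SuperOp (∀ o, Sys m (Fin dY) o) (∀ o, Sys k (Fin dC' × Fin dC) o) :=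
    measurePrepare (fun u => Matrix.single u u 1) fun u => outputState Λ fun i => u (some i)
  refine ⟨Φ, _, _, ?_, generates_of_choi hC (fun x => by rw [h₀]; exact hch.2) ?_⟩
  · exact isCausal_measurePrepare (fun u => isState_outputState hC hΛ _) fun S u v h =>
      marginal_outputState hΛ S fun i hi => h _ hi
  · intro a x
    have hΦ : Φ (joinOp (fun i => Matrix.single (x i) (x i) 1) (ketbra y)) = outputState Λ x := by
      simp only [Φ, measurePrepare_apply, trace_single_mul]
      rw [sum_joinIdx fun u => joinOp (fun i => Matrix.single (x i) (x i) 1) (ketbra y) u u •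
        outputState Λ fun i => u (some i)]
      rw [Finset.sum_eq_single x]
      · refine (Finset.sum_congr rfl fun t _ => ?_ :
          _ = ∑ t, ketbra y t t • outputState Λ x).trans ?_
        · simp only [joinOp_apply, Matrix.single_apply_same, Finset.prod_const_one, mul_one]
          rfl
        · rw [← Finset.sum_smul]
          exact (congrArg (· • outputState Λ x) (trace_ketbra hy)).trans (one_smul _ _)
      · intro x' _ hx'
        obtain ⟨i, hi⟩ := Function.ne_iff.mp hx'
        refine Finset.sum_eq_zero fun t _ => ?_
        rw [joinOp_apply, Finset.prod_eq_zero (Finset.mem_univ i), mul_zero, zero_smul]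
        simp [Ne.symm hi]
      · simp
    rw [hΦ]
    ext p q
    rw [traceParties_joinOp_mul_apply, trace_joinOp_mul_outputState, trace_single_mul,
      Finset.sum_eq_single a]
    · simp
    · intro b _ hb
      obtain ⟨i, hi⟩ := Function.ne_iff.mp hb
      rw [Finset.prod_eq_zero (Finset.mem_univ i), zero_smul]
      simp [Ne.symm hi]
    · simp

/-- For a causal channel, effects of the parties in `I` leave the last party in a conditional
state that depends only on the inputs of the parties in `I`. -/
lemma IsCausal.traceParties_eq {T : Type} [Fintype T] [DecidableEq T]
    {Φ : SuperOp (∀ o, Sys m (Fin dY) o) (∀ o, Sys k T o)} (hΦ : IsCausal Φ)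
    (I : Finset (Fin n)) {A : ∀ i, Matrix (Fin (k i)) (Fin (k i)) ℂ} (hA : ∀ i, i ∉ I → A i = 1)
    {K K' : ∀ i, Matrix (Fin (m i)) (Fin (m i)) ℂ} (hK : ∀ i ∈ I, K i = K' i)
    (htr : ∀ i, (K i).trace = (K' i).trace) (L : Matrix (Fin dY) (Fin dY) ℂ) :
    traceParties (joinOp A (1 : Matrix T T ℂ) * Φ (joinOp K L)) =
      traceParties (joinOp A (1 : Matrix T T ℂ) * Φ (joinOp K' L)) := by
  obtain ⟨Ψ, -, hΨ⟩ := hΦ.2 (Finset.insertNone I)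
  have hmarg : marginal (Finset.insertNone I) (joinOp K L) =
      marginal (Finset.insertNone I) (joinOp K' L) := by
    rw [joinOp_eq, joinOp_eq, marginal_piTensor, marginal_piTensor]
    congr 1
    · refine Finset.prod_congr rfl ?_
      rintro ⟨_ | i, hi⟩ -
      · exact absurd Finset.none_mem_insertNone hi
      · exact htr i
    · refine congrArg piTensor (funext ?_)
      rintro ⟨_ | i, hi⟩
      · rfl
      · exact hK i (Finset.some_mem_insertNone.mp hi)
  ext p q
  have hone : ∀ o, o ∉ Finset.insertNone I → joinFam A (Matrix.single q p (1 : ℂ)) o = 1 := by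
    rintro (_ | i) hi
    · exact absurd Finset.none_mem_insertNone hi
    · exact hA i fun h => hi (Finset.some_mem_insertNone.mpr h)
  rw [traceParties_joinOp_mul_apply, traceParties_joinOp_mul_apply, joinOp_eq A,
    trace_piTensor_mul_of_eq_one _ _ hone, trace_piTensor_mul_of_eq_one _ _ hone, hΨ, hΨ, hmarg]

lemma sum_joinOp_glue {T : Type} (I : Finset (Fin n))
    (B : ∀ i, Fin (k i) → Matrix (Fin (k i)) (Fin (k i)) ℂ) (hB : ∀ i, ∑ b, B i b = 1)
    (N : Matrix T T ℂ) (a : ∀ i : {i // i ∈ I}, Fin (k i)) :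
    ∑ b : ∀ i : {i // i ∉ I}, Fin (k i), joinOp (fun i => B i
        ((Equiv.piEquivPiSubtypeProd (· ∈ I) fun i => Fin (k i)).symm (a, b) i)) N =
      joinOp (fun i => if h : i ∈ I then B i (a ⟨i, h⟩) else 1) N := by
  have key : ∀ s t : ∀ i, Fin (k i), ∑ b : ∀ i : {i // i ∉ I}, Fin (k i), ∏ i, B i
        ((Equiv.piEquivPiSubtypeProd (· ∈ I) fun i => Fin (k i)).symm (a, b) i) (s i) (t i) =
      ∏ i, (if h : i ∈ I then B i (a ⟨i, h⟩) else 1) (s i) (t i) := by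
    intro s t
    rw [sum_prod_glue I (fun i b => B i b (s i) (t i)), prod_subtype_split I]
    congr 1
    · exact Finset.prod_congr rfl fun i _ => by rw [dif_pos i.2]
    · refine Finset.prod_congr rfl fun i _ => ?_
      rw [dif_neg i.2, ← hB, Matrix.sum_apply]
  simp only [joinOp_eq]
  ext u v
  rw [piTensor_joinFam_apply, Matrix.sum_apply]
  simp only [piTensor_joinFam_apply]
  rw [← Finset.mul_sum]
  exact congrArg _ (key (fun i => u (some i)) fun i => v (some i))

theorem IsNSAssemblage.of_isCausal (hm : ∀ i, 0 < m i) (hC : 0 < dC)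
    {y : EuclideanSpace ℂ (Fin dY)} {Λ : Family m k dC dC'}
    (hΛ : ∀ a x, IsCP (Λ a x))
    {Φ : SuperOp (∀ o, Sys m (Fin dY) o) (∀ o, Sys k (Fin dC' × Fin dC) o)}
    {eA : ∀ i, OrthonormalBasis (Fin (k i)) ℂ (EuclideanSpace ℂ (Fin (k i)))}
    {eX : ∀ i, OrthonormalBasis (Fin (m i)) ℂ (EuclideanSpace ℂ (Fin (m i)))}
    (hΦ : IsCausal Φ) (hgen : Generates Φ eA eX y Λ) : IsNSAssemblage Λ := by
  obtain ⟨hgen, hmarg⟩ := hgen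
  have htr : ∀ x x' : ∀ i, Fin (m i), ∀ i,
      (ketbra (eX i (x i))).trace = (ketbra (eX i (x' i))).trace := fun x x' i => by
    rw [trace_ketbra ((eX i).norm_eq_one _), trace_ketbra ((eX i).norm_eq_one _)]
  let x₀ : ∀ i, Fin (m i) := fun i => ⟨0, hm i⟩
  have hsum : ∀ x, ∑ a, Λ a x =
      choiInv (traceParties (Φ (joinOp (fun i => ketbra (eX i (x i))) (ketbra y)))) := by
    intro x
    simp only [hgen]
    rw [← choiInv_sum, sum_traceParties_joinOp_mul (B := fun i a => ketbra (eA i a))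
      fun i => sum_ketbra (eA i)]
  refine ⟨hΛ, ⟨∑ a, Λ a x₀, ⟨IsCP.sum _ fun a => hΛ a x₀, ?_⟩, fun x => ?_⟩, fun I _ _ => ?_⟩
  · rw [hsum]
    exact trace_choiInv_of_traceFst hC (hmarg x₀)
  · have h := hΦ.traceParties_eq ∅ (A := fun _ => 1) (fun _ _ => rfl)
      (K := fun i => ketbra (eX i (x i))) (K' := fun i => ketbra (eX i (x₀ i)))
      (by simp) (htr x x₀) (ketbra y)
    rw [joinOp_one_one, one_mul, one_mul] at h
    rw [hsum, hsum, h]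
  · refine ⟨fun a x => ∑ b : ∀ i : {i // i ∉ I}, Fin (k i),
      Λ ((Equiv.piEquivPiSubtypeProd (· ∈ I) fun i => Fin (k i)).symm (a, b))
        ((Equiv.piEquivPiSubtypeProd (· ∈ I) fun i => Fin (m i)).symm (x, fun i => x₀ i)),
      fun a x => ?_⟩
    simp only [hgen]
    rw [← choiInv_sum, ← choiInv_sum, ← traceParties_sum, ← traceParties_sum, ← Finset.sum_mul,
      ← Finset.sum_mul, sum_joinOp_glue I (fun i a => ketbra (eA i a)) fun i => sum_ketbra (eA i)]
    refine congrArg _ (hΦ.traceParties_eq I (fun i hi => dif_neg hi) (fun i hi => ?_)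
      (fun i => htr x _ i) _)
    rw [glue_mem hi]

end NoSignaling

/-! ### Quantum assemblages and localizable channels -/

section Quantum

variable {n : ℕ} {m k : Fin n → ℕ} {dC dC' dY : ℕ}

lemma exists_eq_joinMap_ancilla {S T : Type} {r : Option (Fin n) → ℕ}
    (Ψ : ∀ o, SuperOp (Sys m S o × Fin (r o)) (Sys k T o)) :
    ∃ (M : ∀ i, SuperOp (Fin (m i) × Fin (r (some i))) (Fin (k i)))
      (N : SuperOp (S × Fin (r none)) T),
      Ψ = joinMap (R := fun o => Sys m S o × Fin (r o)) M N :=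
  ⟨fun i => Ψ (some i), Ψ none, funext fun o => by cases o <;> rfl⟩

/-- The conditional outputs of a localizable channel on a product input: effects measured on the
shared state, the last share of which has been sent through the map of the last party. -/
lemma traceParties_joinOp_mul_withAncilla {S T : Type} [Fintype S] [DecidableEq S] [Fintype T]
    [DecidableEq T] {r : Option (Fin n) → ℕ} (A : ∀ i, Matrix (Fin (k i)) (Fin (k i)) ℂ)
    (Ψ : ∀ i, SuperOp (Fin (m i) × Fin (r (some i))) (Fin (k i)))
    (Ψ₀ : SuperOp (S × Fin (r none)) T)
    (K : ∀ i, Matrix (Fin (m i)) (Fin (m i)) ℂ) (L : Matrix S S ℂ)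
    (σ : Matrix (∀ o, Fin (r o)) (∀ o, Fin (r o)) ℂ) :
    traceParties (joinOp A (1 : Matrix T T ℂ) *
        tensorMap (joinMap (R := fun o => Sys m S o × Fin (r o)) Ψ Ψ₀)
          (withAncilla (joinOp K L) σ)) =
      traceFst ((piTensor (fun i => dualOp (fixFst (Ψ i) (K i)) (A i)) ⊗ₖ (1 : Matrix T T ℂ)) *
        applyLast (R := fun o => Fin (r o)) (fixFst Ψ₀ L) σ) := by
  rw [joinOp_eq K, tensorMap_withAncilla_piTensor,
    ← traceParties_joinOp_mul_tensorMap (R := fun o => Fin (r o))]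
  refine congrArg (fun Ξ => traceParties (joinOp A (1 : Matrix T T ℂ) * tensorMap Ξ σ))
    (funext fun o => ?_)
  cases o <;> rfl

lemma traceFst_kronecker_one_mul_apply {α β : Type} [Fintype α] [Fintype β] [DecidableEq β]
    (B : Matrix α α ℂ) (M : Matrix (α × β) (α × β) ℂ) (p q : β) :
    traceFst ((B ⊗ₖ (1 : Matrix β β ℂ)) * M) p q = ∑ s, ∑ t, B s t * M (t, p) (s, q) := by
  simp [traceFst, Matrix.mul_apply, Fintype.sum_prod_type, Matrix.kroneckerMap_apply,
    Matrix.one_apply]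

/-- The map `Z ↦ Tr₁[(B ⊗ 1) E(ρ ⊗ Z)]`. -/
def conditionalMap {α β γ : Type} [Fintype α] [Fintype γ] [DecidableEq γ]
    (E : SuperOp (α × β) (α × γ)) (ρ B : Matrix α α ℂ) : SuperOp β γ where
  toFun Z := traceFst ((B ⊗ₖ (1 : Matrix γ γ ℂ)) * E (ρ ⊗ₖ Z))
  map_add' Z W := by
    ext p q
    rw [Matrix.kronecker_add, map_add, Matrix.add_apply]
    simp only [traceFst_kronecker_one_mul_apply]
    simp only [Matrix.add_apply, mul_add, Finset.sum_add_distrib]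
  map_smul' c Z := by
    ext p q
    simp only [traceFst_kronecker_one_mul_apply, Matrix.kronecker_smul, map_smul,
      Matrix.smul_apply, smul_eq_mul, mul_left_comm, Finset.mul_sum, RingHom.id_apply]

lemma conditionalMap_apply {α β γ : Type} [Fintype α] [Fintype γ] [DecidableEq γ]
    (E : SuperOp (α × β) (α × γ)) (ρ B : Matrix α α ℂ) (Z : Matrix β β ℂ) :
    conditionalMap E ρ B Z = traceFst ((B ⊗ₖ (1 : Matrix γ γ ℂ)) * E (ρ ⊗ₖ Z)) := rfl

lemma trace_conditionalMap_one {α β γ : Type} [Fintype α] [DecidableEq α] [Fintype β] [Fintype γ]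
    [DecidableEq γ] {E : SuperOp (α × β) (α × γ)} (hE : IsChannel E) {ρ : Matrix α α ℂ}
    (hρ : IsState ρ) (Z : Matrix β β ℂ) : (conditionalMap E ρ 1 Z).trace = Z.trace := by
  rw [conditionalMap_apply, Matrix.one_kronecker_one, one_mul, trace_traceFst, hE.2,
    Matrix.trace_kronecker, hρ.2, one_mul]

/-- The operator `(E ⊗ id)(ρ ⊗ |Ω⟩⟨Ω|)` on `ℂ^α ⊗ (ℂ^γ ⊗ ℂ^d)`, with `|Ω⟩` the maximally
entangled vector. -/
def steeredState {α γ : Type} {d : ℕ} (E : SuperOp (α × Fin d) (α × γ)) (ρ : Matrix α α ℂ) :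
    Matrix (α × (γ × Fin d)) (α × (γ × Fin d)) ℂ :=
  (ampliation E d ((ρ ⊗ₖ maxEntangled d).submatrix (fun u => (u.1.1, (u.1.2, u.2)))
    fun u => (u.1.1, (u.1.2, u.2)))).submatrix (fun u => ((u.1, u.2.1), u.2.2))
      fun u => ((u.1, u.2.1), u.2.2)

lemma posSemidef_steeredState {α γ : Type} [Fintype α] {d : ℕ} {E : SuperOp (α × Fin d) (α × γ)}
    (hE : IsCP E) {ρ : Matrix α α ℂ} (hρ : ρ.PosSemidef) : (steeredState E ρ).PosSemidef :=
  (hE d _ ((hρ.kronecker (posSemidef_maxEntangled d)).submatrix _)).submatrix _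

lemma traceFst_mul_steeredState {α γ : Type} [Fintype α] [Fintype γ] [DecidableEq γ] {d : ℕ}
    (E : SuperOp (α × Fin d) (α × γ)) (ρ B : Matrix α α ℂ) :
    traceFst ((B ⊗ₖ (1 : Matrix (γ × Fin d) (γ × Fin d) ℂ)) * steeredState E ρ) =
      choi (conditionalMap E ρ B) := by
  ext u v
  have h : (Matrix.of fun p q : α × Fin d => (ρ ⊗ₖ maxEntangled d)
      (p.1, (p.2, u.2)) (q.1, (q.2, v.2))) =
      (1 / (d : ℂ)) • (ρ ⊗ₖ Matrix.single u.2 v.2 1) := by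
    ext p q
    simp [maxEntangled, Matrix.kroneckerMap_apply, Matrix.single_apply, eq_comm, mul_comm]
  simp only [traceFst_kronecker_one_mul_apply, choi, Matrix.of_apply, conditionalMap_apply,
    steeredState, ampliation, Matrix.submatrix_apply, h, map_smul, Matrix.smul_apply, smul_eq_mul,
    Finset.mul_sum]
  exact Finset.sum_congr rfl fun s _ => Finset.sum_congr rfl fun t _ => mul_left_comm _ _ _

lemma sum_piTensor {ι : Type} [Fintype ι] [DecidableEq ι] {X ω : ι → Type} [∀ i, Fintype (ω i)]
    (B : ∀ i, ω i → Matrix (X i) (X i) ℂ) :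
    ∑ a : ∀ i, ω i, piTensor (fun i => B i (a i)) = piTensor fun i => ∑ b, B i b := by
  ext u v
  simp only [Matrix.sum_apply, piTensor, Matrix.of_apply]
  rw [Finset.prod_univ_sum, Fintype.piFinset_univ]

lemma conditionalMap_sum {α β γ : Type} [Fintype α] [Fintype γ] [DecidableEq γ]
    (E : SuperOp (α × β) (α × γ)) (ρ : Matrix α α ℂ) {ω : Type} [Fintype ω]
    (B : ω → Matrix α α ℂ) :
    ∑ a, conditionalMap E ρ (B a) = conditionalMap E ρ (∑ a, B a) := by
  refine LinearMap.ext fun Z => ?_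
  ext p q
  simp only [LinearMap.sum_apply, Matrix.sum_apply, conditionalMap_apply,
    traceFst_kronecker_one_mul_apply, Finset.sum_mul]
  rw [Finset.sum_comm]
  exact Finset.sum_congr rfl fun s _ => Finset.sum_comm

/-- The channel that measures the setting `x` in the standard basis, then the POVM `P x`, and
writes down the outcome. -/
def measureMap {μ κ δ : ℕ} (P : Fin μ → Fin κ → Matrix (Fin δ) (Fin δ) ℂ) :
    SuperOp (Fin μ × Fin δ) (Fin κ) :=
  measurePrepare (fun j : Fin μ × Fin κ => Matrix.single j.1 j.1 1 ⊗ₖ P j.1 j.2)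
    fun j => Matrix.single j.2 j.2 1

lemma isState_single {α : Type} [Fintype α] [DecidableEq α] (a : α) :
    IsState (Matrix.single a a (1 : ℂ)) :=
  ⟨isPOVM_single.1 a, Matrix.trace_single_eq_same a 1⟩

lemma isChannel_measureMap {μ κ δ : ℕ} {P : Fin μ → Fin κ → Matrix (Fin δ) (Fin δ) ℂ}
    (hP : ∀ x, IsPOVM (P x)) : IsChannel (measureMap P) := by
  refine isChannel_measurePrepare ⟨fun j => (isPOVM_single.1 j.1).kronecker ((hP j.1).1 j.2), ?_⟩
    fun j => isState_single _
  rw [Fintype.sum_prod_type, ← Matrix.one_kronecker_one, ← (isPOVM_single (α := Fin μ)).2]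
  ext u v
  simp only [Matrix.sum_apply, Matrix.kroneckerMap_apply, ← Finset.mul_sum, Finset.sum_mul]
  refine Finset.sum_congr rfl fun x _ => ?_
  rw [← Matrix.sum_apply, (hP x).2, ← (hP x).2, Matrix.sum_apply]

lemma dualOp_measureMap {μ κ δ : ℕ} (P : Fin μ → Fin κ → Matrix (Fin δ) (Fin δ) ℂ) (x : Fin μ)
    (a : Fin κ) :
    dualOp (fixFst (measureMap P) (Matrix.single x x 1)) (Matrix.single a a 1) = P x a := by
  ext s t
  simp only [dualOp, Matrix.of_apply, trace_single_mul, fixFst_apply, measureMap,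
    measurePrepare_apply, ← Matrix.mul_kronecker_mul, Matrix.trace_kronecker, trace_mul_single,
    Matrix.sum_apply, Matrix.smul_apply, smul_eq_mul, Fintype.sum_prod_type]
  simp [Matrix.single_apply]

/-- A quantum realization on shares of dimensions `r (some i)` gives a localizable channel in which
the untrusted parties measure their shares of the steered state, while the last party discards its
input and outputs its share `C' ⊗ C`, which `e` encodes in `Fin (r none)`. -/
lemma exists_isLocalizable_of_realization (hC : 0 < dC) {y : EuclideanSpace ℂ (Fin dY)}
    (hy : ‖y‖ = 1) {Λ : Family m k dC dC'} {r : Option (Fin n) → ℕ}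
    (e : Fin (r none) ≃ Fin dC' × Fin dC)
    {ρ : Matrix (∀ i, Fin (r (some i))) (∀ i, Fin (r (some i))) ℂ}
    {P : ∀ i, Fin (m i) → Fin (k i) → Matrix (Fin (r (some i))) (Fin (r (some i))) ℂ}
    {E : SuperOp ((∀ i, Fin (r (some i))) × Fin dC) ((∀ i, Fin (r (some i))) × Fin dC')}
    (hρ : IsState ρ) (hP : ∀ i x, IsPOVM (P i x)) (hE : IsChannel E)
    (hcond : ∀ a x, Λ a x = conditionalMap E ρ (piTensor fun i => P i (x i) (a i))) :
    ∃ Φ : SuperOp (∀ o, Sys m (Fin dY) o) (∀ o, Sys k (Fin dC' × Fin dC) o),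
      IsLocalizable Φ ∧ Generates Φ (fun _ => EuclideanSpace.basisFun _ ℂ)
        (fun _ => EuclideanSpace.basisFun _ ℂ) y Λ := by
  have hsum : ∀ x, ∑ a, Λ a x = conditionalMap E ρ 1 := by
    intro x
    simp only [hcond, conditionalMap_sum]
    rw [sum_piTensor fun i b => P i (x i) b]
    simp only [(hP _ _).2, piTensor_one]
  let g : (∀ o, Fin (r o)) → (∀ i, Fin (r (some i))) × (Fin dC' × Fin dC) := fun u =>
    (fun i => u (some i), e (u none))
  let σ : Matrix (∀ o, Fin (r o)) (∀ o, Fin (r o)) ℂ := (steeredState E ρ).submatrix g g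
  have hσ : IsState σ := by
    refine ⟨(posSemidef_steeredState hE.1 hρ.1).submatrix g, ?_⟩
    have h1 := traceFst_mul_steeredState E ρ 1
    rw [Matrix.one_kronecker_one, one_mul] at h1
    rw [← trace_choi hC (trace_conditionalMap_one hE hρ), ← h1, trace_traceFst]
    simp only [Matrix.trace, Matrix.diag_apply]
    rw [sum_optJoin (R := fun o => Fin (r o)), Fintype.sum_prod_type]
    refine Finset.sum_congr rfl fun s _ => ?_
    exact e.sum_comp fun t : Fin dC' × Fin dC => steeredState E ρ (s, t) (s, t)
  let Ψ₀ : SuperOp (Fin dY × Fin (r none)) (Fin dC' × Fin dC) :=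
    sumSubmatrix fun (t : Fin dY) (p : Fin dC' × Fin dC) => (t, e.symm p)
  have hΨ₀ : IsChannel Ψ₀ := by
    refine ⟨isCP_sumSubmatrix _, fun M => ?_⟩
    simp only [Matrix.trace, Matrix.diag_apply, Ψ₀, sumSubmatrix_apply]
    rw [Finset.sum_comm, Fintype.sum_prod_type (α₁ := Fin dY)]
    exact Finset.sum_congr rfl fun t _ => e.symm.sum_comp fun l => M (t, l) (t, l)
  have hlast : applyLast (R := fun o => Fin (r o)) (fixFst Ψ₀ (ketbra y)) σ = steeredState E ρ := by
    ext u v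
    simp only [applyLast, Matrix.of_apply, fixFst_apply, Ψ₀, sumSubmatrix_apply,
      Matrix.kroneckerMap_apply, ← Finset.sum_mul]
    have hg : ∀ u : (∀ i, Fin (r (some i))) × (Fin dC' × Fin dC),
        g (optJoin (R := fun o => Fin (r o)) u.1 (e.symm u.2)) = u := fun u =>
      Prod.ext rfl (e.apply_symm_apply u.2)
    have hk : ∑ t, ketbra y t t = 1 := trace_ketbra hy
    rw [hk, one_mul]
    exact congrArg₂ (steeredState E ρ) (hg u) (hg v)
  let Ψ : ∀ o, SuperOp (Sys m (Fin dY) o × Fin (r o)) (Sys k (Fin dC' × Fin dC) o) :=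
    joinMap (R := fun o => Sys m (Fin dY) o × Fin (r o)) (fun i => measureMap (P i)) Ψ₀
  let Φ : SuperOp (∀ o, Sys m (Fin dY) o) (∀ o, Sys k (Fin dC' × Fin dC) o) :=
    { toFun := fun M => tensorMap Ψ (withAncilla M σ)
      map_add' := fun M N => by
        rw [← map_add]
        exact congrArg _ (by ext; simp [withAncilla, add_mul])
      map_smul' := fun c M => by
        rw [RingHom.id_apply, ← map_smul]
        exact congrArg _ (by ext; simp [withAncilla, mul_assoc]) }
  refine ⟨Φ, ⟨r, σ, Ψ, hσ, fun o => ?_, fun M => rfl⟩, generates_of_choi hC (fun x => ?_) ?_⟩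
  · cases o
    · exact hΨ₀
    · exact isChannel_measureMap (hP _)
  · rw [hsum]
    exact trace_conditionalMap_one hE hρ
  · intro a x
    refine (traceParties_joinOp_mul_withAncilla _ _ _ _ _ _).trans ?_
    rw [hlast, hcond, ← traceFst_mul_steeredState]
    exact congrArg (fun B => traceFst ((piTensor B ⊗ₖ
      (1 : Matrix (Fin dC' × Fin dC) (Fin dC' × Fin dC) ℂ)) * steeredState E ρ))
      (funext fun i => dualOp_measureMap (P i) (x i) (a i))

/-- The dimensions of the shares of the common state: `d i` for the untrusted party `i`, and `e`
for the last party. -/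
def shareDim (d : Fin n → ℕ) (e : ℕ) : Option (Fin n) → ℕ
  | none => e
  | some i => d i

theorem IsQuantumAssemblage.exists_isLocalizable (hC : 0 < dC)
    {y : EuclideanSpace ℂ (Fin dY)} (hy : ‖y‖ = 1) {Λ : Family m k dC dC'}
    (hΛ : IsQuantumAssemblage Λ) :
    ∃ (Φ : SuperOp (∀ o, Sys m (Fin dY) o) (∀ o, Sys k (Fin dC' × Fin dC) o))
      (eA : ∀ i, OrthonormalBasis (Fin (k i)) ℂ (EuclideanSpace ℂ (Fin (k i))))
      (eX : ∀ i, OrthonormalBasis (Fin (m i)) ℂ (EuclideanSpace ℂ (Fin (m i)))),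
      IsLocalizable Φ ∧ Generates Φ eA eX y Λ := by
  obtain ⟨-, d, ρ, P, E, hρ, hP, hE, hform⟩ := hΛ
  exact ⟨_, _, _, (exists_isLocalizable_of_realization (r := shareDim d (dC' * dC)) hC hy
    finProdFinEquiv.symm hρ hP hE fun a x =>
      superOp_ext_of_state fun ρC hρC => hform a x ρC hρC).choose_spec⟩

/-- The channel that discards the first factor and applies the map with Choi matrix `τ`
to the second factor. -/
def discardChoi {α β : Type} [Fintype α] [DecidableEq α] [Fintype β] [DecidableEq β] {d : ℕ}
    (τ : Matrix (α × (β × Fin d)) (α × (β × Fin d)) ℂ) : SuperOp (α × Fin d) (α × β) :=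
  choiInv (τ.submatrix (fun u => (u.1.1, (u.1.2, u.2))) fun u => (u.1.1, (u.1.2, u.2))) ∘ₗ
    sumSubmatrix fun (s : α) (p : Fin d) => (s, p)

lemma isChannel_discardChoi {α β : Type} [Fintype α] [DecidableEq α] [Fintype β] [DecidableEq β]
    {d : ℕ} (hd : 0 < d) {τ : Matrix (α × (β × Fin d)) (α × (β × Fin d)) ℂ} (hτ : τ.PosSemidef)
    (htr : traceFst (traceFst τ) = (1 / (d : ℂ)) • (1 : Matrix (Fin d) (Fin d) ℂ)) :
    IsChannel (discardChoi τ) := by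
  refine ⟨(isCP_choiInv (hτ.submatrix _)).comp (isCP_sumSubmatrix _), fun M => ?_⟩
  rw [discardChoi, LinearMap.comp_apply, trace_choiInv_of_traceFst hd,
    ← traceFst_eq_sumSubmatrix, trace_traceFst]
  rw [← htr]
  ext p q
  simp only [traceFst, Matrix.of_apply, Matrix.submatrix_apply, Fintype.sum_prod_type]
  exact Finset.sum_comm

/-- Effects on the first output of `discardChoi τ` steer the Choi matrix. -/
lemma traceFst_mul_discardChoi {α β : Type} [Fintype α] [DecidableEq α] [Fintype β]
    [DecidableEq β] {d : ℕ} (τ : Matrix (α × (β × Fin d)) (α × (β × Fin d)) ℂ) (B : Matrix α α ℂ)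
    {ρ : Matrix α α ℂ} (hρ : ρ.trace = 1) (Z : Matrix (Fin d) (Fin d) ℂ) :
    traceFst ((B ⊗ₖ (1 : Matrix β β ℂ)) * discardChoi τ (ρ ⊗ₖ Z)) =
      choiInv (traceFst ((B ⊗ₖ (1 : Matrix (β × Fin d) (β × Fin d) ℂ)) * τ)) Z := by
  have hZ : sumSubmatrix (fun (s : α) (p : Fin d) => (s, p)) (ρ ⊗ₖ Z) = Z := by
    ext p q
    have hρ' : ∑ s, ρ s s = 1 := hρ
    simp [sumSubmatrix_apply, Matrix.kroneckerMap_apply, ← Finset.sum_mul, hρ']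
  ext p q
  rw [discardChoi, LinearMap.comp_apply, hZ]
  simp only [traceFst_kronecker_one_mul_apply, choiInv_apply, Matrix.submatrix_apply,
    Finset.mul_sum]
  refine (Finset.sum_congr rfl fun s _ => Finset.sum_comm).trans (Finset.sum_comm.trans ?_)
  refine Finset.sum_congr rfl fun p' _ => ?_
  refine (Finset.sum_congr rfl fun s _ => Finset.sum_comm).trans (Finset.sum_comm.trans ?_)
  refine Finset.sum_congr rfl fun q' _ => Finset.sum_congr rfl fun s _ =>
    Finset.sum_congr rfl fun t _ => ?_
  ring

theorem IsQuantumAssemblage.of_isLocalizable (hm : ∀ i, 0 < m i) (hC : 0 < dC)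
    {y : EuclideanSpace ℂ (Fin dY)} {Λ : Family m k dC dC'}
    (hΛ : ∀ a x, IsCP (Λ a x))
    {Φ : SuperOp (∀ o, Sys m (Fin dY) o) (∀ o, Sys k (Fin dC' × Fin dC) o)}
    {eA : ∀ i, OrthonormalBasis (Fin (k i)) ℂ (EuclideanSpace ℂ (Fin (k i)))}
    {eX : ∀ i, OrthonormalBasis (Fin (m i)) ℂ (EuclideanSpace ℂ (Fin (m i)))}
    (hΦ : IsLocalizable Φ) (hgen : Generates Φ eA eX y Λ) : IsQuantumAssemblage Λ := by
  obtain ⟨r, σ, T, hσ, hT, hform⟩ := hΦ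
  obtain ⟨hgen, hmarg⟩ := hgen
  obtain ⟨Ψ, Ψ₀, rfl⟩ := exists_eq_joinMap_ancilla T
  have hΨ : ∀ i, IsChannel (Ψ i : SuperOp (Fin (m i) × Fin (r (some i))) (Fin (k i))) :=
    fun i => hT (some i)
  have hΨ₀ : IsChannel (Ψ₀ : SuperOp (Fin dY × Fin (r none)) (Fin dC' × Fin dC)) := hT none
  have hK : ∀ i x, IsState (ketbra (eX i x)) := fun i x =>
    ⟨posSemidef_ketbra _, trace_ketbra ((eX i).norm_eq_one x)⟩
  let τ : Matrix ((∀ i, Fin (r (some i))) × (Fin dC' × Fin dC)) _ ℂ :=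
    applyLast (R := fun o => Fin (r o)) (fixFst Ψ₀ (ketbra y)) σ
  have hτ : τ.PosSemidef :=
    posSemidef_applyLast (R := fun o => Fin (r o)) (isCP_fixFst hΨ₀.1 (posSemidef_ketbra y)) hσ.1
  let P : ∀ i, Fin (m i) → Fin (k i) → Matrix (Fin (r (some i))) (Fin (r (some i))) ℂ :=
    fun i x a => dualOp (fixFst (Ψ i) (ketbra (eX i x))) (ketbra (eA i a))
  have hP : ∀ i x, IsPOVM (P i x) := fun i x =>
    isPOVM_dualOp (isChannel_fixFst (hΨ i) (hK i x)) (isPOVM_ketbra (eA i))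
  have hcond : ∀ (a : ∀ i, Fin (k i)) (x : ∀ i, Fin (m i)), traceParties
      (joinOp (fun i => ketbra (eA i (a i))) (1 : Matrix (Fin dC' × Fin dC) (Fin dC' × Fin dC) ℂ) *
      Φ (joinOp (fun i => ketbra (eX i (x i))) (ketbra y))) =
      traceFst ((piTensor (fun i => P i (x i) (a i)) ⊗ₖ
        (1 : Matrix (Fin dC' × Fin dC) (Fin dC' × Fin dC) ℂ)) * τ) := by
    intro a x
    rw [hform]
    exact traceParties_joinOp_mul_withAncilla _ _ _ _ _ _
  have htr : traceFst (traceFst τ) = (1 / (dC : ℂ)) • (1 : Matrix (Fin dC) (Fin dC) ℂ) := by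
    let x₀ : ∀ i, Fin (m i) := fun i => ⟨0, hm i⟩
    rw [← hmarg x₀, ← sum_traceParties_joinOp_mul (B := fun i a => ketbra (eA i a))
      fun i => sum_ketbra (eA i)]
    simp only [hcond]
    have : ∑ a : ∀ i, Fin (k i), traceFst ((piTensor (fun i => P i (x₀ i) (a i)) ⊗ₖ
        (1 : Matrix (Fin dC' × Fin dC) (Fin dC' × Fin dC) ℂ)) * τ) =
        traceFst (((∑ a : ∀ i, Fin (k i), piTensor fun i => P i (x₀ i) (a i)) ⊗ₖ
          (1 : Matrix (Fin dC' × Fin dC) (Fin dC' × Fin dC) ℂ)) * τ) := by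
      ext p q
      simp only [Matrix.sum_apply, traceFst_kronecker_one_mul_apply, Finset.sum_mul]
      rw [Finset.sum_comm]
      exact Finset.sum_congr rfl fun s _ => Finset.sum_comm
    rw [this, sum_piTensor fun i b => P i (x₀ i) b]
    simp only [(hP _ _).2, piTensor_one, Matrix.one_kronecker_one, one_mul]
  have hne : Nonempty (∀ o, Fin (r o)) := by
    by_contra h
    rw [not_nonempty_iff] at h
    have := hσ.2
    rw [Matrix.trace, Finset.univ_eq_empty, Finset.sum_empty] at this
    exact zero_ne_one this
  let s₀ : ∀ i, Fin (r (some i)) := fun i => hne.some (some i)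
  refine ⟨hΛ, fun i => r (some i), Matrix.single s₀ s₀ 1, P, discardChoi τ, isState_single s₀, hP,
    isChannel_discardChoi hC hτ htr, fun a x ρC _ => ?_⟩
  rw [traceFst_mul_discardChoi τ _ (isState_single s₀).2, ← hcond, hgen]

end Quantum

/-! ### Local assemblages and local channels -/

section Local

variable {n : ℕ} {m k : Fin n → ℕ} {dC dC' dY : ℕ}

lemma exists_eq_joinMap {S T : Type} (Ψ : ∀ o, SuperOp (Sys m S o) (Sys k T o)) :
    ∃ (M : ∀ i, SuperOp (Fin (m i)) (Fin (k i))) (N : SuperOp S T),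
      Ψ = joinMap (R := Sys m S) M N :=
  ⟨fun i => Ψ (some i), Ψ none, funext fun o => by cases o <;> rfl⟩

lemma tensorMap_joinMap_joinOp {S T : Type} [Fintype S] [DecidableEq S]
    (Ψ : ∀ i, SuperOp (Fin (m i)) (Fin (k i))) (Ψ₀ : SuperOp S T)
    (K : ∀ i, Matrix (Fin (m i)) (Fin (m i)) ℂ) (L : Matrix S S ℂ) :
    tensorMap (joinMap (R := Sys m S) Ψ Ψ₀) (joinOp K L) =
      joinOp (fun i => Ψ i (K i)) (Ψ₀ L) := by
  rw [joinOp_eq, joinOp_eq, tensorMap_piTensor]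
  exact congrArg piTensor (funext fun o => by cases o <;> rfl)

lemma traceParties_joinOp_mul_sum_tensorMap {S T : Type} [Fintype S] [DecidableEq S] [Fintype T]
    [DecidableEq T] {ω : Type} [Fintype ω] (q : ω → ℂ)
    (Ψ : ω → ∀ i, SuperOp (Fin (m i)) (Fin (k i))) (Ψ₀ : ω → SuperOp S T)
    (A : ∀ i, Matrix (Fin (k i)) (Fin (k i)) ℂ) (K : ∀ i, Matrix (Fin (m i)) (Fin (m i)) ℂ)
    (L : Matrix S S ℂ) :
    traceParties (joinOp A (1 : Matrix T T ℂ) *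
      (∑ j, q j • tensorMap (joinMap (R := Sys m S) (Ψ j) (Ψ₀ j))) (joinOp K L)) =
      ∑ j, (∏ i, (A i * Ψ j i (K i)).trace) • q j • Ψ₀ j L := by
  simp only [LinearMap.sum_apply, LinearMap.smul_apply, tensorMap_joinMap_joinOp, Finset.mul_sum,
    Matrix.mul_smul, traceParties_sum, traceParties_smul, traceParties_joinOp_mul_joinOp]
  exact Finset.sum_congr rfl fun j _ => smul_comm _ _ _

theorem IsLocalAssemblage.exists_isLocal (hC : 0 < dC)
    {y : EuclideanSpace ℂ (Fin dY)} (hy : ‖y‖ = 1) {Λ : Family m k dC dC'}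
    (hΛ : IsLocalAssemblage Λ) :
    ∃ (Φ : SuperOp (∀ o, Sys m (Fin dY) o) (∀ o, Sys k (Fin dC' × Fin dC) o))
      (eA : ∀ i, OrthonormalBasis (Fin (k i)) ℂ (EuclideanSpace ℂ (Fin (k i))))
      (eX : ∀ i, OrthonormalBasis (Fin (m i)) ℂ (EuclideanSpace ℂ (Fin (m i)))),
      IsLocal Φ ∧ Generates Φ eA eX y Λ := by
  obtain ⟨-, N, p, L, hp, hp1, hL, hch, hform⟩ := hΛ
  have hsum : ∀ x, ∑ a, Λ a x = ∑ j, L j := by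
    intro x
    simp only [hform]
    rw [Finset.sum_comm]
    refine Finset.sum_congr rfl fun j _ => ?_
    rw [← Finset.sum_smul, ← Complex.ofReal_sum]
    have : ∑ a : ∀ i, Fin (k i), ∏ i, p j i (x i) (a i) = 1 := by
      have h := Finset.prod_univ_sum (fun i => (Finset.univ : Finset (Fin (k i))))
        fun i b => p j i (x i) b
      rw [Fintype.piFinset_univ] at h
      rw [← h]
      exact Finset.prod_eq_one fun i _ => hp1 j i _
    rw [this, Complex.ofReal_one, one_smul]
  have hpos : ∀ j, (choi (L j)).PosSemidef := fun j => posSemidef_choi (hL j)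
  let q : Fin N → ℝ := fun j => (choi (L j)).trace.re
  have hq : ∀ j, (q j : ℂ) = (choi (L j)).trace := fun j =>
    Complex.ext rfl (Complex.nonneg_iff.mp (hpos j).trace_nonneg).2
  have hq0 : ∀ j, 0 ≤ q j := fun j => (Complex.nonneg_iff.mp (hpos j).trace_nonneg).1
  have hq1 : ∑ j, q j = 1 := by
    have : ((∑ j, q j : ℝ) : ℂ) = 1 := by
      rw [Complex.ofReal_sum]
      simp only [hq]
      rw [← Matrix.trace_sum, ← choi_sum, trace_choi hC hch.2]
    exact_mod_cast this
  have hprep : ∀ j, ∃ ρ : Matrix (Fin dC' × Fin dC) (Fin dC' × Fin dC) ℂ,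
      IsState ρ ∧ (q j : ℂ) • ρ = choi (L j) := by
    intro j
    by_cases h0 : (q j : ℂ) = 0
    · -- A term of weight zero vanishes, so any state will do.
      refine ⟨choi (∑ j, L j), ⟨posSemidef_choi hch.1, trace_choi hC hch.2⟩, ?_⟩
      rw [h0, zero_smul, (hpos j).trace_eq_zero_iff.mp (by rw [← hq, h0])]
    · refine ⟨(q j : ℂ)⁻¹ • choi (L j), ⟨(hpos j).smul ?_, ?_⟩, smul_inv_smul₀ h0 _⟩
      · rw [← Complex.ofReal_inv]
        exact_mod_cast inv_nonneg.mpr (hq0 j)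
      · rw [Matrix.trace_smul, ← hq, smul_eq_mul, inv_mul_cancel₀ h0]
  choose ρ hρ hρL using hprep
  let Ψ : Fin N → ∀ i, SuperOp (Fin (m i)) (Fin (k i)) := fun j i =>
    measurePrepare (fun x => Matrix.single x x 1) fun x =>
      ∑ b, (p j i x b : ℂ) • Matrix.single b b 1
  let Ψ₀ : Fin N → SuperOp (Fin dY) (Fin dC' × Fin dC) := fun j =>
    measurePrepare (fun _ : Unit => 1) fun _ => ρ j
  have hΨ : ∀ j i, IsChannel (Ψ j i) := fun j i => by
    refine isChannel_measurePrepare isPOVM_single fun x => ⟨Matrix.posSemidef_sum _ fun b _ =>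
      (isPOVM_single.1 b).smul (by exact_mod_cast hp j i x b), ?_⟩
    simp only [Matrix.trace_sum, Matrix.trace_smul, Matrix.trace_single_eq_same, smul_eq_mul,
      mul_one]
    exact_mod_cast hp1 j i x
  have hΨ₀ : ∀ j, IsChannel (Ψ₀ j) := fun j =>
    isChannel_measurePrepare ⟨fun _ => Matrix.PosSemidef.one, by simp⟩ fun _ => hρ j
  refine ⟨∑ j, (q j : ℂ) • tensorMap (joinMap (R := Sys m (Fin dY)) (Ψ j) (Ψ₀ j)), _, _,
    ⟨N, q, fun j => joinMap (R := Sys m (Fin dY)) (Ψ j) (Ψ₀ j), hq0, hq1, fun j o => ?_, rfl⟩,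
    generates_of_choi hC (fun x => ?_) fun a x => ?_⟩
  · cases o
    · exact hΨ₀ j
    · exact hΨ j _
  · rw [hsum]
    exact hch.2
  · rw [traceParties_joinOp_mul_sum_tensorMap, hform, choi_sum]
    refine Finset.sum_congr rfl fun j _ => ?_
    have h0 : Ψ₀ j (ketbra y) = ρ j := by
      simp [Ψ₀, measurePrepare_apply, trace_ketbra hy]
    have h1 : ∀ i, (Matrix.single (a i) (a i) 1 * Ψ j i (Matrix.single (x i) (x i) 1)).trace =
        (p j i (x i) (a i) : ℂ) := by
      intro i
      have h2 : Ψ j i (Matrix.single (x i) (x i) 1) =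
          ∑ b, (p j i (x i) b : ℂ) • Matrix.single b b 1 := by
        simp only [Ψ, measurePrepare_apply, trace_single_mul]
        rw [Finset.sum_eq_single (x i) (fun c _ hc => by simp [Ne.symm hc]) (by simp),
          Matrix.single_apply_same, one_smul]
      rw [trace_single_mul, h2, Matrix.sum_apply, Finset.sum_eq_single (a i)
        (fun c _ hc => by simp [hc]) (by simp)]
      simp
    simp only [h1, h0, hρL, choi_smul, Complex.ofReal_prod]

theorem IsLocalAssemblage.of_isLocal (hm : ∀ i, 0 < m i) (hC : 0 < dC)
    {y : EuclideanSpace ℂ (Fin dY)} {Λ : Family m k dC dC'}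
    (hΛ : ∀ a x, IsCP (Λ a x))
    {Φ : SuperOp (∀ o, Sys m (Fin dY) o) (∀ o, Sys k (Fin dC' × Fin dC) o)}
    {eA : ∀ i, OrthonormalBasis (Fin (k i)) ℂ (EuclideanSpace ℂ (Fin (k i)))}
    {eX : ∀ i, OrthonormalBasis (Fin (m i)) ℂ (EuclideanSpace ℂ (Fin (m i)))}
    (hΦ : IsLocal Φ) (hgen : Generates Φ eA eX y Λ) : IsLocalAssemblage Λ := by
  obtain ⟨N, q, T, hq, -, hT, rfl⟩ := hΦ
  obtain ⟨hgen, hmarg⟩ := hgen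
  choose Ψ Ψ₀ hTΨ using fun j => exists_eq_joinMap (T j)
  simp only [hTΨ] at hT hgen hmarg
  have hΨ : ∀ j i, IsChannel (Ψ j i : SuperOp (Fin (m i)) (Fin (k i))) :=
    fun j i => hT j (some i)
  have hΨ₀ : ∀ j, IsChannel (Ψ₀ j : SuperOp (Fin dY) (Fin dC' × Fin dC)) := fun j => hT j none
  have hform := traceParties_joinOp_mul_sum_tensorMap (fun j => (q j : ℂ)) Ψ Ψ₀
  have hnonneg : ∀ j i x a, 0 ≤ (ketbra (eA i a) * Ψ j i (ketbra (eX i x))).trace :=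
    fun j i x a => trace_mul_nonneg (posSemidef_ketbra _)
      ((hΨ j i).1.posSemidef (posSemidef_ketbra _))
  have hsum : ∀ j i x, ∑ a, (ketbra (eA i a) * Ψ j i (ketbra (eX i x))).trace = 1 := by
    intro j i x
    rw [← Matrix.trace_sum, ← Finset.sum_mul, sum_ketbra, one_mul, (hΨ j i).2,
      trace_ketbra ((eX i).norm_eq_one x)]
  let p : Fin N → ∀ i, Fin (m i) → Fin (k i) → ℝ := fun j i x a =>
    (ketbra (eA i a) * Ψ j i (ketbra (eX i x))).trace.re
  have hp : ∀ j i x a, (p j i x a : ℂ) = (ketbra (eA i a) * Ψ j i (ketbra (eX i x))).trace :=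
    fun j i x a => Complex.ext rfl (Complex.nonneg_iff.mp (hnonneg j i x a)).2
  let Y : Fin N → Matrix (Fin dC' × Fin dC) (Fin dC' × Fin dC) ℂ := fun j =>
    (q j : ℂ) • Ψ₀ j (ketbra y)
  have hY : ∀ j, (Y j).PosSemidef := fun j =>
    ((hΨ₀ j).1.posSemidef (posSemidef_ketbra y)).smul (by exact_mod_cast hq j)
  refine ⟨hΛ, N, p, fun j => choiInv (Y j), fun j i x a => ?_, fun j i x => ?_,
    fun j => isCP_choiInv (hY j), ⟨IsCP.sum _ fun j => isCP_choiInv (hY j), ?_⟩, fun a x => ?_⟩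
  · exact (Complex.nonneg_iff.mp (hnonneg j i x a)).1
  · have : ((∑ b, p j i x b : ℝ) : ℂ) = 1 := by
      rw [Complex.ofReal_sum]
      simp only [hp, hsum]
    exact_mod_cast this
  · rw [← choiInv_sum]
    refine trace_choiInv_of_traceFst hC ?_
    let x₀ : ∀ i, Fin (m i) := fun i => ⟨0, hm i⟩
    rw [← hmarg x₀]
    have h := hform (fun _ => 1) (fun i => ketbra (eX i (x₀ i))) (ketbra y)
    rw [joinOp_one_one, one_mul] at h
    rw [h]
    refine congrArg traceFst (Finset.sum_congr rfl fun j _ => ?_)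
    rw [Finset.prod_eq_one, one_smul]
    intro i _
    rw [one_mul, (hΨ j i).2, trace_ketbra ((eX i).norm_eq_one _)]
  · rw [hgen, hform, choiInv_sum]
    refine Finset.sum_congr rfl fun j _ => ?_
    rw [choiInv_smul, Complex.ofReal_prod]
    simp only [hp]
    rfl

end Local

end ChannelAssemblage

end

theorem theorem5 {n : ℕ} (m k : Fin n → ℕ) (hm : ∀ i, 0 < m i) (hk : ∀ i, 0 < k i)
    (dC dC' : ℕ) (hC : 0 < dC) (hC' : 0 < dC')
    (dY : ℕ) (y : EuclideanSpace ℂ (Fin dY)) (hy : ‖y‖ = 1)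
    (Λ : ChannelAssemblage.Family m k dC dC')
    (hΛ : ∀ a x, ChannelAssemblage.IsCP (Λ a x)) :
    (ChannelAssemblage.IsNSAssemblage Λ ↔
      ∃ (Φ : ChannelAssemblage.SuperOp (∀ o, ChannelAssemblage.Sys m (Fin dY) o)
          (∀ o, ChannelAssemblage.Sys k (Fin dC' × Fin dC) o))
        (eA : ∀ i, OrthonormalBasis (Fin (k i)) ℂ (EuclideanSpace ℂ (Fin (k i))))
        (eX : ∀ i, OrthonormalBasis (Fin (m i)) ℂ (EuclideanSpace ℂ (Fin (m i)))),
        ChannelAssemblage.IsCausal Φ ∧ ChannelAssemblage.Generates Φ eA eX y Λ) ∧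
    (ChannelAssemblage.IsQuantumAssemblage Λ ↔
      ∃ (Φ : ChannelAssemblage.SuperOp (∀ o, ChannelAssemblage.Sys m (Fin dY) o)
          (∀ o, ChannelAssemblage.Sys k (Fin dC' × Fin dC) o))
        (eA : ∀ i, OrthonormalBasis (Fin (k i)) ℂ (EuclideanSpace ℂ (Fin (k i))))
        (eX : ∀ i, OrthonormalBasis (Fin (m i)) ℂ (EuclideanSpace ℂ (Fin (m i)))),
        ChannelAssemblage.IsLocalizable Φ ∧ ChannelAssemblage.Generates Φ eA eX y Λ) ∧
    (ChannelAssemblage.IsLocalAssemblage Λ ↔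
      ∃ (Φ : ChannelAssemblage.SuperOp (∀ o, ChannelAssemblage.Sys m (Fin dY) o)
          (∀ o, ChannelAssemblage.Sys k (Fin dC' × Fin dC) o))
        (eA : ∀ i, OrthonormalBasis (Fin (k i)) ℂ (EuclideanSpace ℂ (Fin (k i))))
        (eX : ∀ i, OrthonormalBasis (Fin (m i)) ℂ (EuclideanSpace ℂ (Fin (m i)))),
        ChannelAssemblage.IsLocal Φ ∧ ChannelAssemblage.Generates Φ eA eX y Λ) := by
  exact ⟨⟨fun h => h.exists_isCausal hm hC hy,
      fun ⟨_, _, _, hΦ, hgen⟩ => .of_isCausal hm hC hΛ hΦ hgen⟩,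
    ⟨fun h => h.exists_isLocalizable hC hy,
      fun ⟨_, _, _, hΦ, hgen⟩ => .of_isLocalizable hm hC hΛ hΦ hgen⟩,
    ⟨fun h => h.exists_isLocal hC hy,
      fun ⟨_, _, _, hΦ, hgen⟩ => .of_isLocal hm hC hΛ hΦ hgen⟩⟩
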